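/- Let $n\ge 0$, $J=[0,\infty)$ and let $A\colon J\to\mathbb R^{n\times n}$ be of bounded variation on every compact interval $[a,b]\subset J$. With $\Delta^{+}A(t)=A(t^{+})-A(t)$ and $\Delta^{-}A(t)=A(t)-A(t^{-})$, assume (D) $I-\Delta^{-}A(t)$ is invertible for every $t>0$ and $I+\Delta^{+}A(t)$ is invertible for every $t\ge 0$. Assume moreover that there are $\omega>0$ and a constant matrix $C\in\mathbb R^{n\times n}$ with $A(t+\omega)-A(t)=C$ for all $t\ge 0$. Integrals are understood as follows. For $a\le b$ and $G\colon[a,b]\times[a,b]\to X$ with $X$ a Banach space, the Kurzweil integral $\int_a^b DG(\tau,t)$ is the element $v\in X$ (if it exists) such that for every $\varepsilon>0$ there is $\delta\colon[a,b]\to(0,\infty)$ with $\bigl\|\sum_j [G(\tau_j,\alpha_j)-G(\tau_j,\alpha_{j-1})]-v\bigr\|<\varepsilon$ for all partitions $a=\alpha_0<\dots<\alpha_\nu=b$ with tags $\tau_j\in[\alpha_{j-1},\alpha_j]\subset(\tau_j-\delta(\tau_j),\tau_j+\delta(\tau_j))$; and $\int_b^a=-\int_a^b$. We write $\int_a^b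 \mathrm d[A(s)]\,x(s)$ for the case $G(\tau,t)=A(t)x(\tau)$. A solution of the homogeneous generalized linear differential equation $$\frac{dx}{d\tau}=D[A(t)x]\qquad(\ast)$$ on an interval $J'\subset J$ is a function $x\colon J'\to\mathbb R^n$ such that $x(d)-x(c)=\int_c^d \mathrm d[A(s)]\,x(s)$ (in particular, the integral exists) for all $c,d\in J'$. The trivial solution of $(\ast)$ is called globally uniformly exponentially stable if there are constants $\alpha,K>0$ such that for every $s_0\ge 0$ and every solution $x$ of $(\ast)$ on $[s_0,\infty)$, $$\|x(t)\|\le K\|x(s_0)\|e^{-\alpha(t-s_0)}\quad\text{for all } t\ge s_0 .$$ Then there is a unique $U\colon J\times J\to\mathbb R^{n\times n}$ (the transition matrix of $(\ast)$) with $U(t,s)=I+\int_s^t \mathrm d[A(r)]\,U(r,s)$ for all $t,s\in J$, and the trivial solution of $(\ast)$ is globally uniformly exponentially stable if and only if every (complex) eigenvalue $\rho$ of the monodromy matrix $X(\omega)=U(\omega,0)$ satisfies $|\rho|<1$. -/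

import Mathlib

open Set

open scoped Matrix.Norms.L2Operator

namespace GLDE

/-- A tagged partition `a = pt 0 < pt 1 < ⋯ < pt ν = b` of `[a, b]` with tags
`tag j ∈ [pt j, pt (j + 1)]` for `j < ν`. Values of `pt` and `tag` at later indices are
irrelevant. For `a = b` only `ν = 0` is possible. -/
structure TaggedPartition (a b : ℝ) where
  ν : ℕ
  pt : ℕ → ℝ
  tag : ℕ → ℝ
  pt_zero : pt 0 = a
  pt_last : pt ν = b
  pt_lt : ∀ j < ν, pt j < pt (j + 1)
  tag_mem : ∀ j < ν, tag j ∈ Icc (pt j) (pt (j + 1))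

/-- `δ`-fineness of a tagged partition. -/
def TaggedPartition.IsFine {a b : ℝ} (P : TaggedPartition a b) (δ : ℝ → ℝ) : Prop :=
  ∀ j < P.ν, Icc (P.pt j) (P.pt (j + 1)) ⊆
    Ioo (P.tag j - δ (P.tag j)) (P.tag j + δ (P.tag j))

/-- The Kurzweil sum `∑ [G(τ_j, α_j) - G(τ_j, α_{j-1})]`. -/
def TaggedPartition.sum {X : Type*} [NormedAddCommGroup X] {a b : ℝ}
    (P : TaggedPartition a b) (G : ℝ → ℝ → X) : X :=
  ∑ j ∈ Finset.range P.ν, (G (P.tag j) (P.pt (j + 1)) - G (P.tag j) (P.pt j))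

/-- For `a ≤ b`: `G` is Kurzweil integrable on `[a, b]` and its integral is `v`. -/
def HasIntegralIcc {X : Type*} [NormedAddCommGroup X]
    (G : ℝ → ℝ → X) (a b : ℝ) (v : X) : Prop :=
  ∀ ε > 0, ∃ δ : ℝ → ℝ, (∀ t ∈ Icc a b, 0 < δ t) ∧
    ∀ P : TaggedPartition a b, P.IsFine δ → ‖P.sum G - v‖ < ε

/-- The oriented Kurzweil integral: `∫_a^b DG(τ, t)` exists and equals `v`, where
`∫_a^b = -∫_b^a` when `b < a`. -/
def HasIntegral {X : Type*} [NormedAddCommGroup X]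
    (G : ℝ → ℝ → X) (a b : ℝ) (v : X) : Prop :=
  (a ≤ b → HasIntegralIcc G a b v) ∧ (b < a → HasIntegralIcc G b a (-v))

/-- `x` solves the homogeneous generalized linear differential equation `dx/dτ = D[A(t)x]`
on the interval `J`: `x(d) - x(c) = ∫_c^d d[A(s)] x(s)` for all `c, d ∈ J`. -/
def IsSolutionOn {n : ℕ} (A : ℝ → Matrix (Fin n) (Fin n) ℝ)
    (x : ℝ → EuclideanSpace ℝ (Fin n)) (J : Set ℝ) : Prop :=
  ∀ c ∈ J, ∀ d ∈ J,
    HasIntegral (fun τ t => Matrix.toEuclideanCLM (𝕜 := ℝ) (A t) (x τ)) c d (x d - x c)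

/-- `U` is a transition matrix on `[0, ∞)`: `U(t, s) = I + ∫_s^t d[A(r)] U(r, s)`
for all `t, s ≥ 0`. -/
def IsTransitionMatrix {n : ℕ} (A : ℝ → Matrix (Fin n) (Fin n) ℝ)
    (U : ℝ → ℝ → Matrix (Fin n) (Fin n) ℝ) : Prop :=
  ∀ t ∈ Ici (0 : ℝ), ∀ s ∈ Ici (0 : ℝ),
    HasIntegral (fun τ r => A r * U τ s) s t (U t s - 1)

/-- Condition (D): `I - Δ⁻A(t)` is invertible for all `t > 0` and `I + Δ⁺A(t)` is invertible
for all `t ≥ 0`. -/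
def ConditionD {n : ℕ} (A : ℝ → Matrix (Fin n) (Fin n) ℝ) : Prop :=
  (∀ t > 0, IsUnit (1 - (A t - Function.leftLim A t))) ∧
    ∀ t ≥ 0, IsUnit (1 + (Function.rightLim A t - A t))

/-- Global uniform exponential stability of the trivial solution of `dx/dτ = D[A(t)x]` on
`[0, ∞)`. The inequality is not strict, since it has to hold for `x₀ = 0` too. -/
def GloballyUniformlyExponentiallyStable {n : ℕ} (A : ℝ → Matrix (Fin n) (Fin n) ℝ) : Prop :=
  ∃ α > 0, ∃ K > 0, ∀ s₀ ≥ 0, ∀ x : ℝ → EuclideanSpace ℝ (Fin n),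
    IsSolutionOn A x (Ici s₀) →
      ∀ t ≥ s₀, ‖x t‖ ≤ K * ‖x s₀‖ * Real.exp (-α * (t - s₀))

end GLDE

/-!
Condition (D) makes the jump factors of `dx/dτ = D[A(t)x]` invertible. After extending `A` to the
left of `0` by a constant, every half-open interval `(t, s]` with `s` close to `t` has small
variation, so the integral operator contracts there: a zero solution stays zero, and Picard
iteration solves the equation. The jump factors carry solutions across `t` in both directions,
reflection in time treats the intervals `[s, t)`, and gluing gives invertible transition matrices
`U(t, s)`.

Since `dA` is `ω`-periodic, uniqueness gives `U(t + ω, s + ω) = U(t, s)`, hence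
`U(r + kω, s) = U(r, 0) X(ω)^k U(0, s)`. For `r, s ∈ [0, ω]` the outer factors are bounded, because
regulated functions are bounded on compact intervals. So uniform exponential decay of `U` means
`X(ω)^k → 0`, which by Gelfand's formula means that the spectral radius of `X(ω)` is less than `1`.
-/

namespace GLDE

open Filter Topology

open scoped Pointwise

section Filters

variable {a b t : ℝ}

theorem interval_induction {P : ℝ → ℝ → Prop} (hab : a ≤ b) (refl : ∀ t, P t t)
    (trans : ∀ ⦃r s t⦄, r ≤ s → s ≤ t → P r s → P s t → P r t)
    (right : ∀ t ∈ Ico a b, ∀ᶠ s in 𝓝[>] t, P t s)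
    (left : ∀ t ∈ Ioc a b, ∀ᶠ s in 𝓝[<] t, P s t) : P a b := by
  set T := {t | t ∈ Icc a b ∧ P a t}
  have ha : a ∈ T := ⟨left_mem_Icc.2 hab, refl a⟩
  have hT : IsLUB T (sSup T) := isLUB_csSup ⟨a, ha⟩ ⟨b, fun t ht => ht.1.2⟩
  set m := sSup T
  have ham : a ≤ m := hT.1 ha
  have hmb : m ≤ b := hT.2 fun t ht => ht.1.2
  have hPm : P a m := by
    rcases ham.eq_or_lt with h | h
    · exact h ▸ refl a
    have hleft : ∀ᶠ s in 𝓝[≤] m, P s m := by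
      rw [← Iio_insert, nhdsWithin_insert, eventually_sup]
      exact ⟨refl m, left m ⟨h, hmb⟩⟩
    obtain ⟨s, hs, hsm, hsm'⟩ := ((hT.frequently_mem ⟨a, ha⟩).and_eventually
      (hleft.and eventually_mem_nhdsWithin)).exists
    exact trans hs.1.1 hsm' hs.2 hsm
  rcases hmb.eq_or_lt with h | h
  · exact h ▸ hPm
  obtain ⟨s, hs, hms⟩ := ((right m ⟨ham, h⟩).and (Ioc_mem_nhdsGT h)).exists
  exact absurd (hT.1 ⟨⟨ham.trans hms.1.le, hms.2⟩, trans ham hms.1.le hPm hs⟩) hms.1.not_ge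

theorem eventually_forall_Ioc {p : ℝ → Prop} (h : ∀ᶠ r in 𝓝[>] t, p r) :
    ∀ᶠ s in 𝓝[>] t, ∀ r ∈ Ioc t s, p r := by
  obtain ⟨u, hu, hp⟩ := mem_nhdsGT_iff_exists_Ioc_subset.1 h
  filter_upwards [Ioc_mem_nhdsGT hu] with s hs r hr
  exact hp ⟨hr.1, hr.2.trans hs.2⟩

end Filters

section Kurzweil

variable {X Y : Type*} [NormedAddCommGroup X] [NormedAddCommGroup Y]

/-- `FineSum G δ a b S`: the value `S` is the Kurzweil sum of `G` over some `δ`-fine tagged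
partition of `[a, b]`. The inductive form lets partitions be concatenated and split without
reindexing. -/
inductive FineSum (G : ℝ → ℝ → X) (δ : ℝ → ℝ) : ℝ → ℝ → X → Prop
  | nil (a : ℝ) : FineSum G δ a a 0
  | cons {a c b τ : ℝ} {S : X} (hac : a < c) (hτ : τ ∈ Icc a c)
      (hδ : Icc a c ⊆ Ioo (τ - δ τ) (τ + δ τ)) (h : FineSum G δ c b S) :
      FineSum G δ a b (G τ c - G τ a + S)

variable {G G' : ℝ → ℝ → X} {δ δ' : ℝ → ℝ} {a b c s t : ℝ} {S S' v w : X}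

namespace FineSum

theorem le (h : FineSum G δ a b S) : a ≤ b := by
  induction h with
  | nil a => exact le_rfl
  | cons hac _ _ _ ih => exact hac.le.trans ih

theorem append (h : FineSum G δ a b S) (h' : FineSum G δ b c S') :
    FineSum G δ a c (S + S') := by
  induction h with
  | nil a => simpa using h'
  | cons hac hτ hδ _ ih => rw [add_assoc]; exact .cons hac hτ hδ (ih h')

theorem mono (h : FineSum G δ a b S) (hδ : ∀ t ∈ Icc a b, δ t ≤ δ' t) :
    FineSum G δ' a b S := by
  induction h with
  | nil a => exact .nil a
  | cons hac hτ hf h ih =>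
    have := hδ _ ⟨hτ.1, hτ.2.trans h.le⟩
    exact .cons hac hτ (hf.trans (Ioo_subset_Ioo (by linarith) (by linarith)))
      (ih fun t ht => hδ t ⟨hac.le.trans ht.1, ht.2⟩)

theorem congr_sub (h : FineSum G δ a b S)
    (hG : ∀ τ ∈ Icc a b, ∀ s ∈ Icc a b, ∀ t ∈ Icc a b, G τ t - G τ s = G' τ t - G' τ s) :
    FineSum G' δ a b S := by
  induction h with
  | nil a => exact .nil a
  | cons hac hτ hf h ih =>
    have hcb := h.le
    rw [hG _ ⟨hτ.1, hτ.2.trans hcb⟩ _ ⟨le_rfl, hac.le.trans hcb⟩ _ ⟨hac.le, hcb⟩]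
    exact .cons hac hτ hf (ih fun τ hτ s hs t ht => hG τ ⟨hac.le.trans hτ.1, hτ.2⟩
      s ⟨hac.le.trans hs.1, hs.2⟩ t ⟨hac.le.trans ht.1, ht.2⟩)

theorem single {τ : ℝ} (hac : a < c) (hτ : τ ∈ Icc a c)
    (hδ : Icc a c ⊆ Ioo (τ - δ τ) (τ + δ τ)) : FineSum G δ a c (G τ c - G τ a) := by
  simpa using FineSum.cons (G := G) hac hτ hδ (.nil c)

theorem eq_sub {g : ℝ → X} (h : FineSum (fun _ => g) δ a b S) : S = g b - g a := by
  induction h with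
  | nil a => simp
  | cons _ _ _ _ ih => rw [ih]; abel

theorem eq_zero (h : FineSum G δ a a S) : S = 0 := by
  cases h with
  | nil => rfl
  | cons hac _ _ h => exact absurd h.le hac.not_ge

theorem of_neg (h : FineSum (fun τ t => G (-τ) (-t)) (fun t => δ (-t)) a b S) :
    FineSum G δ (-b) (-a) (-S) := by
  induction h with
  | nil a => simpa using FineSum.nil (G := G) (δ := δ) (-a)
  | @cons a c b τ S hac hτ hf _ ih =>
    have h : FineSum G δ (-c) (-a) (G (-τ) (-a) - G (-τ) (-c)) := by
      refine .single (neg_lt_neg hac) ⟨neg_le_neg hτ.2, neg_le_neg hτ.1⟩ fun r hr => ?_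
      have := hf ⟨le_neg_of_le_neg hr.2, neg_le_of_neg_le hr.1⟩
      constructor <;> linarith [this.1, this.2]
    convert ih.append h using 1
    abel

theorem of_add (h : FineSum (fun τ t => G (τ + s) (t + s)) (fun t => δ (t + s)) a b S) :
    FineSum G δ (a + s) (b + s) S := by
  induction h with
  | nil a => exact .nil _
  | cons hac hτ hf _ ih =>
    refine .cons (by gcongr) ⟨by gcongr; exact hτ.1, by gcongr; exact hτ.2⟩ (fun r hr => ?_) ih
    have := hf ⟨le_sub_iff_add_le.2 hr.1, sub_le_iff_le_add.2 hr.2⟩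
    constructor <;> linarith [this.1, this.2]

/-- A gauge that isolates `b` forces every fine partition to split at `b`. -/
theorem split (h : FineSum G δ a c S) (hab : a ≤ b) (hbc : b ≤ c)
    (hδ : ∀ t ∈ Icc a c, t ≠ b → δ t ≤ |t - b|) :
    ∃ S₁ S₂, FineSum G δ a b S₁ ∧ FineSum G δ b c S₂ ∧ S = S₁ + S₂ := by
  induction h with
  | nil a =>
    obtain rfl := le_antisymm hab hbc
    exact ⟨0, 0, .nil _, .nil _, by simp⟩
  | @cons a d c τ S hac hτ hf h ih =>
    rcases hab.eq_or_lt with rfl | hab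
    · exact ⟨0, _, .nil _, .cons hac hτ hf h, by simp⟩
    rcases le_or_gt d b with hdb | hbd
    · obtain ⟨S₁, S₂, h₁, h₂, rfl⟩ := ih hdb hbc fun t ht =>
        hδ t ⟨hac.le.trans ht.1, ht.2⟩
      exact ⟨_, S₂, .cons hac hτ hf h₁, h₂, by abel⟩
    · have hτb : τ = b := by
        by_contra hne
        have hδτ := hδ τ ⟨hτ.1, hτ.2.trans h.le⟩ hne
        have hb := hf ⟨hab.le, hbd.le⟩
        rcases abs_cases (τ - b) with h | h <;> linarith [hb.1, hb.2]
      subst hτb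
      exact ⟨_, _, .single hab ⟨hab.le, le_rfl⟩ ((Icc_subset_Icc_right hbd.le).trans hf),
        .cons hbd ⟨le_rfl, hbd.le⟩ ((Icc_subset_Icc_left hab.le).trans hf) h, by abel⟩

theorem exists_add (h : FineSum (fun τ t => G τ t + G' τ t) δ a b S) :
    ∃ S₁ S₂, FineSum G δ a b S₁ ∧ FineSum G' δ a b S₂ ∧ S = S₁ + S₂ := by
  induction h with
  | nil a => exact ⟨0, 0, .nil a, .nil a, by simp⟩
  | cons hac hτ hf _ ih =>
    obtain ⟨S₁, S₂, h₁, h₂, rfl⟩ := ih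
    exact ⟨_, _, .cons hac hτ hf h₁, .cons hac hτ hf h₂, by abel⟩

theorem exists_map {T : X →+ Y} {S : Y} (h : FineSum (fun τ t => T (G τ t)) δ a b S) :
    ∃ S', FineSum G δ a b S' ∧ S = T S' := by
  induction h with
  | nil a => exact ⟨0, .nil a, by simp⟩
  | cons hac hτ hf _ ih =>
    obtain ⟨S', h, rfl⟩ := ih
    exact ⟨_, .cons hac hτ hf h, by simp⟩

theorem exists_partition (h : FineSum G δ a b S) :
    ∃ P : TaggedPartition a b, P.IsFine δ ∧ P.sum G = S := by
  induction h with
  | nil a => exact ⟨⟨0, fun _ => a, fun _ => a, rfl, rfl, by simp, by simp⟩,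
      by simp [TaggedPartition.IsFine], by simp [TaggedPartition.sum]⟩
  | @cons a c b τ S hac hτ hf h ih =>
    obtain ⟨P, hP, rfl⟩ := ih
    refine ⟨⟨P.ν + 1, fun j => Nat.casesOn j a P.pt, fun j => Nat.casesOn j τ P.tag, rfl,
      P.pt_last, ?_, ?_⟩, ?_, ?_⟩
    · rintro (_ | j) hj
      · simpa [P.pt_zero] using hac
      · exact P.pt_lt j (by omega)
    · rintro (_ | j) hj
      · simpa [P.pt_zero] using hτ
      · exact P.tag_mem j (by omega)
    · rintro (_ | j) hj
      · simpa [P.pt_zero] using hf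
      · exact hP j (Nat.lt_of_succ_lt_succ hj)
    · simp only [TaggedPartition.sum, Finset.sum_range_succ', P.pt_zero]
      exact add_comm _ _

end FineSum

theorem TaggedPartition.fineSum (P : TaggedPartition a b) (hP : P.IsFine δ) (G : ℝ → ℝ → X) :
    FineSum G δ a b (P.sum G) := by
  obtain ⟨ν, pt, tag, h0, h1, hlt, hmem⟩ := P
  induction ν generalizing a pt tag with
  | zero =>
    obtain rfl : a = b := h0.symm.trans h1
    simpa [TaggedPartition.sum] using FineSum.nil (G := G) (δ := δ) a
  | succ k ih =>
    have htail := ih (a := pt 1) (fun j => pt (j + 1)) (fun j => tag (j + 1)) rfl h1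
      (fun j hj => hlt (j + 1) (by omega)) (fun j hj => hmem (j + 1) (by omega))
      (fun j hj => hP (j + 1) (Nat.succ_lt_succ hj))
    subst h0
    rw [TaggedPartition.sum, Finset.sum_range_succ', add_comm]
    exact .cons (hlt 0 (by omega)) (hmem 0 (by omega)) (hP 0 (Nat.succ_pos k)) htail

/-- Cousin's lemma. -/
theorem exists_fineSum (G : ℝ → ℝ → X) (hab : a ≤ b) (hδ : ∀ t ∈ Icc a b, 0 < δ t) :
    ∃ S, FineSum G δ a b S := by
  refine interval_induction (P := fun s t => ∃ S, FineSum G δ s t S) hab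
    (fun t => ⟨0, .nil t⟩) ?_ (fun t ht => ?_) fun t ht => ?_
  · rintro r s t - - ⟨S, h⟩ ⟨S', h'⟩
    exact ⟨_, h.append h'⟩
  · have hδt := hδ t ⟨ht.1, ht.2.le⟩
    filter_upwards [Ioo_mem_nhdsGT (lt_add_of_pos_right t hδt)] with s hs
    exact ⟨_, .single hs.1 ⟨le_rfl, hs.1.le⟩
      (Icc_subset_Ioo (sub_lt_self t hδt) hs.2)⟩
  · have hδt := hδ t ⟨ht.1.le, ht.2⟩
    filter_upwards [Ioo_mem_nhdsLT (sub_lt_self t hδt)] with s hs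
    exact ⟨_, .single hs.2 ⟨hs.2.le, le_rfl⟩
      (Icc_subset_Ioo hs.1 (lt_add_of_pos_right t hδt))⟩

/-- `v` is an `ε`-approximate Kurzweil integral of `G` on `[a, b]`: all Kurzweil sums that are
fine for a suitable gauge lie within `ε` of `v`. The integral is the value that works for all
`ε > 0`; keeping `ε` explicit lets errors be added up over subintervals. -/
def IsApproxIntegral (G : ℝ → ℝ → X) (a b : ℝ) (v : X) (ε : ℝ) : Prop :=
  ∃ δ : ℝ → ℝ, (∀ t ∈ Icc a b, 0 < δ t) ∧ ∀ S, FineSum G δ a b S → ‖S - v‖ ≤ ε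

variable {ε ε' : ℝ}

namespace IsApproxIntegral

theorem mono (h : IsApproxIntegral G a b v ε) (hε : ε ≤ ε') : IsApproxIntegral G a b v ε' := by
  obtain ⟨δ, hδ, hS⟩ := h
  exact ⟨δ, hδ, fun S h => (hS S h).trans hε⟩

theorem of_eq (h : ∀ S, FineSum G (fun _ => 1) a b S → S = v) : IsApproxIntegral G a b v 0 :=
  ⟨fun _ => 1, fun _ _ => one_pos, fun S hS => by simp [h S hS]⟩

theorem norm_sub_le (hab : a ≤ b) (h : IsApproxIntegral G a b v ε)
    (h' : IsApproxIntegral G a b w ε') : ‖v - w‖ ≤ ε + ε' := by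
  obtain ⟨δ, hδ, hS⟩ := h
  obtain ⟨δ', hδ', hS'⟩ := h'
  obtain ⟨S, h⟩ := exists_fineSum (δ := fun t => min (δ t) (δ' t)) G hab
    fun t ht => lt_min (hδ t ht) (hδ' t ht)
  have hv := hS S (h.mono fun _ _ => min_le_left _ _)
  have hw := hS' S (h.mono fun _ _ => min_le_right _ _)
  rw [← dist_eq_norm] at hv hw ⊢
  linarith [dist_triangle_left v w S]

theorem congr_sub (h : IsApproxIntegral G a b v ε)
    (hG : ∀ τ ∈ Icc a b, ∀ s ∈ Icc a b, ∀ t ∈ Icc a b, G τ t - G τ s = G' τ t - G' τ s) :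
    IsApproxIntegral G' a b v ε := by
  obtain ⟨δ, hδ, hS⟩ := h
  exact ⟨δ, hδ, fun S h => hS S (h.congr_sub fun τ hτ s hs t ht => (hG τ hτ s hs t ht).symm)⟩

theorem neg (h : IsApproxIntegral G a b v ε) :
    IsApproxIntegral (fun τ t => G (-τ) (-t)) (-b) (-a) (-v) ε := by
  obtain ⟨δ, hδ, hS⟩ := h
  refine ⟨fun t => δ (-t), fun t ht => hδ _ ⟨le_neg_of_le_neg ht.2, neg_le_of_neg_le ht.1⟩,
    fun S h => ?_⟩
  rw [show S - -v = -(-S - v) by abel, norm_neg]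
  exact hS (-S) (by simpa using h.of_neg)

theorem comp_add (h : IsApproxIntegral G (a + s) (b + s) v ε) :
    IsApproxIntegral (fun τ t => G (τ + s) (t + s)) a b v ε := by
  obtain ⟨δ, hδ, hS⟩ := h
  exact ⟨fun t => δ (t + s), fun t ht => hδ _ ⟨by gcongr; exact ht.1, by gcongr; exact ht.2⟩,
    fun S h => hS S h.of_add⟩

theorem trans (hab : a ≤ b) (hbc : b ≤ c) (h : IsApproxIntegral G a b v ε)
    (h' : IsApproxIntegral G b c w ε') : IsApproxIntegral G a c (v + w) (ε + ε') := by
  obtain ⟨δ, hδ, hS⟩ := h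
  obtain ⟨δ', hδ', hS'⟩ := h'
  refine ⟨fun t => if t < b then min (δ t) |t - b| else if b < t then min (δ' t) |t - b|
    else min (δ t) (δ' t), fun t ht => ?_, fun S hS₀ => ?_⟩
  · dsimp only
    split_ifs with htb hbt
    · exact lt_min (hδ t ⟨ht.1, htb.le⟩) (abs_pos.2 (sub_ne_zero.2 htb.ne))
    · exact lt_min (hδ' t ⟨hbt.le, ht.2⟩) (abs_pos.2 (sub_ne_zero.2 hbt.ne'))
    · exact lt_min (hδ t ⟨ht.1, not_lt.1 hbt⟩) (hδ' t ⟨not_lt.1 htb, ht.2⟩)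
  · obtain ⟨S₁, S₂, h₁, h₂, rfl⟩ := hS₀.split hab hbc fun t _ htb => by
      rcases lt_or_gt_of_ne htb with h | h
      · simp [h]
      · simp [h, h.not_gt]
    have hv := hS S₁ (h₁.mono fun t ht => by
      rcases ht.2.eq_or_lt with rfl | h
      · simp
      · simp [h])
    have hw := hS' S₂ (h₂.mono fun t ht => by
      rcases ht.1.eq_or_lt with rfl | h
      · simp
      · simp [h, h.not_gt])
    rw [add_sub_add_comm]
    exact norm_add_le_of_le hv hw

theorem sub_left (hab : a ≤ b) (hbc : b ≤ c) (h : IsApproxIntegral G a b v ε)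
    (h' : IsApproxIntegral G a c w ε') : IsApproxIntegral G b c (w - v) (ε' + ε) := by
  obtain ⟨δ, hδ, hS⟩ := h
  obtain ⟨δ', hδ', hS'⟩ := h'
  obtain ⟨S₀, h₀⟩ := exists_fineSum (δ := fun t => min (δ t) (δ' t)) G hab
    fun t ht => lt_min (hδ t ht) (hδ' t ⟨ht.1, ht.2.trans hbc⟩)
  refine ⟨δ', fun t ht => hδ' t ⟨hab.trans ht.1, ht.2⟩, fun S h₁ => ?_⟩
  have hv := hS S₀ (h₀.mono fun _ _ => min_le_left _ _)
  have hw := hS' _ ((h₀.mono fun _ _ => min_le_right _ _).append h₁)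
  rw [show S - (w - v) = S₀ + S - w - (S₀ - v) by abel]
  exact norm_sub_le_of_le hw hv

theorem add (h : IsApproxIntegral G a b v ε) (h' : IsApproxIntegral G' a b w ε') :
    IsApproxIntegral (fun τ t => G τ t + G' τ t) a b (v + w) (ε + ε') := by
  obtain ⟨δ, hδ, hS⟩ := h
  obtain ⟨δ', hδ', hS'⟩ := h'
  refine ⟨fun t => min (δ t) (δ' t), fun t ht => lt_min (hδ t ht) (hδ' t ht), fun S h => ?_⟩
  obtain ⟨S₁, S₂, h₁, h₂, rfl⟩ := h.exists_add
  rw [add_sub_add_comm]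
  exact norm_add_le_of_le (hS S₁ (h₁.mono fun _ _ => min_le_left _ _))
    (hS' S₂ (h₂.mono fun _ _ => min_le_right _ _))

/-- Peels off a first subinterval with tag `a`. -/
theorem eventually_nhdsGT (h : IsApproxIntegral G a b v ε) (hab : a < b) :
    ∀ᶠ t in 𝓝[>] a, IsApproxIntegral G t b (v - (G a t - G a a)) ε := by
  obtain ⟨δ, hδ, hS⟩ := h
  have hδa := hδ a (left_mem_Icc.2 hab.le)
  filter_upwards [Ioo_mem_nhdsGT (lt_add_of_pos_right a hδa)] with t ht
  refine ⟨δ, fun s hs => hδ s ⟨ht.1.le.trans hs.1, hs.2⟩, fun S h => ?_⟩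
  rw [show S - (v - (G a t - G a a)) = G a t - G a a + S - v by abel]
  exact hS _ (.cons ht.1 ⟨le_rfl, ht.1.le⟩ (Icc_subset_Ioo (sub_lt_self a hδa) ht.2) h)

end IsApproxIntegral

theorem hasIntegralIcc_iff :
    HasIntegralIcc G a b v ↔ ∀ ε > 0, IsApproxIntegral G a b v ε := by
  refine ⟨fun h ε hε => ?_, fun h ε hε => ?_⟩
  · obtain ⟨δ, hδ, hP⟩ := h ε hε
    refine ⟨δ, hδ, fun S hS => ?_⟩
    obtain ⟨P, hPδ, rfl⟩ := hS.exists_partition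
    exact (hP P hPδ).le
  · obtain ⟨δ, hδ, hS⟩ := h (ε / 2) (half_pos hε)
    exact ⟨δ, hδ, fun P hP => (hS _ (P.fineSum hP G)).trans_lt (half_lt_self hε)⟩

namespace HasIntegralIcc

theorem of_eq (h : ∀ S, FineSum G (fun _ => 1) a b S → S = v) : HasIntegralIcc G a b v :=
  hasIntegralIcc_iff.2 fun _ hε => (IsApproxIntegral.of_eq h).mono hε.le

theorem norm_sub_le (hab : a ≤ b) (h : HasIntegralIcc G a b v)
    (h' : IsApproxIntegral G a b w ε) : ‖v - w‖ ≤ ε :=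
  le_of_forall_pos_le_add fun η hη => by
    simpa [add_comm] using (hasIntegralIcc_iff.1 h η hη).norm_sub_le hab h'

theorem unique (hab : a ≤ b) (h : HasIntegralIcc G a b v)
    (h' : HasIntegralIcc G a b w) : v = w :=
  eq_of_forall_dist_le fun ε hε => by
    simpa [dist_eq_norm] using h.norm_sub_le hab (hasIntegralIcc_iff.1 h' ε hε)

theorem congr_sub (h : HasIntegralIcc G a b v)
    (hG : ∀ τ ∈ Icc a b, ∀ s ∈ Icc a b, ∀ t ∈ Icc a b, G τ t - G τ s = G' τ t - G' τ s) :
    HasIntegralIcc G' a b v :=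
  hasIntegralIcc_iff.2 fun ε hε => (hasIntegralIcc_iff.1 h ε hε).congr_sub hG

theorem neg (h : HasIntegralIcc G a b v) :
    HasIntegralIcc (fun τ t => G (-τ) (-t)) (-b) (-a) (-v) :=
  hasIntegralIcc_iff.2 fun ε hε => (hasIntegralIcc_iff.1 h ε hε).neg

theorem comp_add (h : HasIntegralIcc G (a + s) (b + s) v) :
    HasIntegralIcc (fun τ t => G (τ + s) (t + s)) a b v :=
  hasIntegralIcc_iff.2 fun ε hε => (hasIntegralIcc_iff.1 h ε hε).comp_add

theorem trans (hab : a ≤ b) (hbc : b ≤ c) (h : HasIntegralIcc G a b v)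
    (h' : HasIntegralIcc G b c w) : HasIntegralIcc G a c (v + w) :=
  hasIntegralIcc_iff.2 fun ε hε => by
    simpa using (hasIntegralIcc_iff.1 h _ (half_pos hε)).trans hab hbc
      (hasIntegralIcc_iff.1 h' _ (half_pos hε))

theorem sub_left (hab : a ≤ b) (hbc : b ≤ c) (h : HasIntegralIcc G a b v)
    (h' : HasIntegralIcc G a c w) : HasIntegralIcc G b c (w - v) :=
  hasIntegralIcc_iff.2 fun ε hε => by
    simpa using (hasIntegralIcc_iff.1 h _ (half_pos hε)).sub_left hab hbc
      (hasIntegralIcc_iff.1 h' _ (half_pos hε))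

theorem sub_right (hab : a ≤ b) (hbc : b ≤ c) (h : HasIntegralIcc G b c v)
    (h' : HasIntegralIcc G a c w) : HasIntegralIcc G a b (w - v) := by
  simpa [neg_add_eq_sub] using (h.neg.sub_left (neg_le_neg hbc) (neg_le_neg hab) h'.neg).neg

theorem add (h : HasIntegralIcc G a b v) (h' : HasIntegralIcc G' a b w) :
    HasIntegralIcc (fun τ t => G τ t + G' τ t) a b (v + w) :=
  hasIntegralIcc_iff.2 fun ε hε => by
    simpa using (hasIntegralIcc_iff.1 h _ (half_pos hε)).add
      (hasIntegralIcc_iff.1 h' _ (half_pos hε))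

theorem map (T : X →+ Y) (hT : Continuous T) (h : HasIntegralIcc G a b v) :
    HasIntegralIcc (fun τ t => T (G τ t)) a b (T v) := by
  rw [hasIntegralIcc_iff] at h ⊢
  intro ε hε
  obtain ⟨η, hη, hTη⟩ := Metric.continuous_iff.1 hT 0 ε hε
  obtain ⟨δ, hδ, hS⟩ := h (η / 2) (half_pos hη)
  refine ⟨δ, hδ, fun S hS' => ?_⟩
  obtain ⟨S', h', rfl⟩ := hS'.exists_map
  simpa using (hTη (S' - v) (by simpa using (hS S' h').trans_lt (half_lt_self hη))).le

/-- The gauge forces the first tag to be `a`, and later tags do not contribute. -/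
theorem pointMass_left {g : ℝ → X} (hab : a < b) (hg : Tendsto g (𝓝[>] a) (𝓝 v)) :
    HasIntegralIcc (fun τ t => if τ = a then g t else 0) a b (v - g a) := by
  rw [hasIntegralIcc_iff]
  intro ε hε
  obtain ⟨u, hau, hu⟩ := mem_nhdsGT_iff_exists_Ioo_subset.1 (Metric.tendsto_nhds.1 hg ε hε)
  refine ⟨fun t => if t = a then u - a else |t - a|, fun t _ => ?_, fun S hS => ?_⟩
  · dsimp only
    split_ifs with h
    · exact sub_pos.2 hau
    · exact abs_pos.2 (sub_ne_zero.2 h)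
  cases hS with
  | nil => exact absurd hab (lt_irrefl a)
  | @cons _ c _ τ S hac hτ hf h =>
    obtain rfl : τ = a := by
      by_contra hne
      have := (hf ⟨le_rfl, hac.le⟩).1
      rw [if_neg hne, abs_of_nonneg (sub_nonneg.2 hτ.1)] at this
      linarith
    obtain rfl : S = 0 := by
      simpa using (h.congr_sub (G' := fun _ _ => 0) fun σ hσ s _ t _ => by
        simp [(hac.trans_le hσ.1).ne']).eq_sub
    have hcu : c < u := by simpa using (hf ⟨hac.le, le_rfl⟩).2
    have hgc : dist (g c) v < ε := hu ⟨hac, hcu⟩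
    simpa [dist_eq_norm] using hgc.le

/-- Cauchy's criterion. -/
theorem exists_of_isApproxIntegral [CompleteSpace X] (hab : a ≤ b)
    (h : ∀ ε > 0, ∃ v, IsApproxIntegral G a b v ε) : ∃ v, HasIntegralIcc G a b v := by
  obtain ⟨ε, -, hε, hlim⟩ := exists_seq_strictAnti_tendsto (0 : ℝ)
  choose v hv using fun n => h (ε n) (hε n)
  have hcauchy : CauchySeq v := by
    rw [Metric.cauchySeq_iff']
    intro η hη
    obtain ⟨N, hN⟩ := eventually_atTop.1 (hlim.eventually_lt_const (half_pos hη))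
    refine ⟨N, fun n hn => ?_⟩
    rw [dist_eq_norm]
    linarith [(hv n).norm_sub_le hab (hv N), hN n hn, hN N le_rfl]
  obtain ⟨w, hw⟩ := cauchySeq_tendsto_of_complete hcauchy
  refine ⟨w, hasIntegralIcc_iff.2 fun η hη => ?_⟩
  obtain ⟨n, hεn, hn⟩ := ((hlim.eventually_lt_const (half_pos hη)).and
    (Metric.tendsto_nhds.1 hw _ (half_pos hη))).exists
  obtain ⟨δ, hδ, hS⟩ := hv n
  refine ⟨δ, hδ, fun S h => ?_⟩
  rw [dist_eq_norm] at hn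
  linarith [norm_sub_le_norm_sub_add_norm_sub S (v n) w, hS S h]

end HasIntegralIcc

namespace HasIntegral

theorem of_le (hab : a ≤ b) (h : HasIntegralIcc G a b v) : HasIntegral G a b v :=
  ⟨fun _ => h, fun h' => absurd hab h'.not_ge⟩

theorem eq_zero (h : HasIntegral G a a v) : v = 0 :=
  (h.1 le_rfl).unique le_rfl <| .of_eq fun _ hS => hS.eq_zero

theorem symm (h : HasIntegral G a b v) : HasIntegral G b a (-v) := by
  refine ⟨fun hba => ?_, fun hab => by simpa using h.1 hab.le⟩
  rcases hba.eq_or_lt with rfl | hba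
  · simpa [h.eq_zero] using h.1 le_rfl
  · exact h.2 hba

theorem trans (h : HasIntegral G a b v) (h' : HasIntegral G b c w) :
    HasIntegral G a c (v + w) := by
  rcases le_total a b with hab | hab <;> rcases le_total b c with hbc | hbc
  · exact .of_le (hab.trans hbc) ((h.1 hab).trans hab hbc (h'.1 hbc))
  · rcases le_total a c with hac | hac
    · exact .of_le hac (by simpa [add_comm] using (h'.symm.1 hbc).sub_right hac hbc (h.1 hab))
    · have := HasIntegralIcc.sub_right hac hab (h.1 hab) (h'.symm.1 hbc)
      simpa [add_comm] using (HasIntegral.of_le hac this).symm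
  · rcases le_total a c with hac | hac
    · exact .of_le hac (by simpa [add_comm] using (h.symm.1 hab).sub_left hab hac (h'.1 hbc))
    · have := HasIntegralIcc.sub_left hbc hac (h'.1 hbc) (h.symm.1 hab)
      simpa [add_comm] using (HasIntegral.of_le hac this).symm
  · have := (h'.symm.1 hbc).trans hbc hab (h.symm.1 hab)
    simpa [add_comm] using (HasIntegral.of_le (hbc.trans hab) this).symm

theorem add (h : HasIntegral G a b v) (h' : HasIntegral G' a b w) :
    HasIntegral (fun τ t => G τ t + G' τ t) a b (v + w) :=
  ⟨fun hab => (h.1 hab).add (h'.1 hab), fun hab => by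
    simpa [add_comm] using (h.2 hab).add (h'.2 hab)⟩

theorem map (T : X →+ Y) (hT : Continuous T) (h : HasIntegral G a b v) :
    HasIntegral (fun τ t => T (G τ t)) a b (T v) :=
  ⟨fun hab => (h.1 hab).map T hT, fun hab => by simpa using (h.2 hab).map T hT⟩

theorem congr_sub (h : HasIntegral G a b v) (hG : ∀ τ ∈ uIcc a b, ∀ s ∈ uIcc a b,
    ∀ t ∈ uIcc a b, G τ t - G τ s = G' τ t - G' τ s) : HasIntegral G' a b v :=
  ⟨fun hab => (h.1 hab).congr_sub (by rwa [uIcc_of_le hab] at hG),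
    fun hab => (h.2 hab).congr_sub (by rwa [uIcc_of_ge hab.le] at hG)⟩

theorem neg (h : HasIntegral G a b v) :
    HasIntegral (fun τ t => G (-τ) (-t)) (-a) (-b) v :=
  ⟨fun hab => by simpa using (h.symm.1 (neg_le_neg_iff.1 hab)).neg,
    fun hba => (h.1 (neg_lt_neg_iff.1 hba).le).neg⟩

theorem comp_add (h : HasIntegral G (a + s) (b + s) v) :
    HasIntegral (fun τ t => G (τ + s) (t + s)) a b v :=
  ⟨fun hab => (h.1 (by gcongr)).comp_add, fun hab => (h.2 (by gcongr)).comp_add⟩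

end HasIntegral

/-- `F` is an indefinite Kurzweil integral of `G` on `J`: `∫_c^d DG(τ, t) = F d - F c` for all
`c, d ∈ J`. -/
def IsIndefiniteIntegralOn (G : ℝ → ℝ → X) (F : ℝ → X) (J : Set ℝ) : Prop :=
  ∀ c ∈ J, ∀ d ∈ J, HasIntegral G c d (F d - F c)

namespace IsIndefiniteIntegralOn

variable {F F' : ℝ → X} {J J' : Set ℝ} {L : X}

theorem mono (h : IsIndefiniteIntegralOn G F J) (hJ : J' ⊆ J) :
    IsIndefiniteIntegralOn G F J' :=
  fun c hc d hd => h c (hJ hc) d (hJ hd)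

theorem of_base (h : ∀ t ∈ J, HasIntegral G s t (F t - F s)) :
    IsIndefiniteIntegralOn G F J := fun c hc d hd => by
  simpa using (h c hc).symm.trans (h d hd)

theorem map (h : IsIndefiniteIntegralOn G F J) (T : X →+ Y) (hT : Continuous T) :
    IsIndefiniteIntegralOn (fun τ t => T (G τ t)) (fun t => T (F t)) J :=
  fun c hc d hd => by simpa using (h c hc d hd).map T hT

theorem sub (h : IsIndefiniteIntegralOn G F J) (h' : IsIndefiniteIntegralOn G' F' J) :
    IsIndefiniteIntegralOn (fun τ t => G τ t - G' τ t) (fun t => F t - F' t) J :=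
  fun c hc d hd => by
    simpa [sub_eq_add_neg, add_add_add_comm, add_comm] using
      (h c hc d hd).add ((h' c hc d hd).map negAddMonoidHom continuous_neg)

theorem congr [J.OrdConnected] (h : IsIndefiniteIntegralOn G F J)
    (hG : ∀ τ ∈ J, ∀ t ∈ J, G τ t = G' τ t) (hF : EqOn F F' J) :
    IsIndefiniteIntegralOn G' F' J := fun c hc d hd => by
  have hcd := OrdConnected.uIcc_subset ‹_› hc hd
  rw [← hF hc, ← hF hd]
  exact (h c hc d hd).congr_sub fun τ hτ s hs t ht => by
    rw [hG _ (hcd hτ) _ (hcd hs), hG _ (hcd hτ) _ (hcd ht)]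

theorem neg (h : IsIndefiniteIntegralOn G F J) :
    IsIndefiniteIntegralOn (fun τ t => G (-τ) (-t)) (fun t => F (-t)) (-J) :=
  fun c hc d hd => by simpa using (h _ hc _ hd).neg

theorem comp_add (h : IsIndefiniteIntegralOn G F J) (s : ℝ) :
    IsIndefiniteIntegralOn (fun τ t => G (τ + s) (t + s)) (fun t => F (t + s))
      ((· + s) ⁻¹' J) :=
  fun _ hc _ hd => (h _ hc _ hd).comp_add

/-- A gauge at `a` compares `F` with the single increment of `G a`. -/
theorem tendsto_nhdsGT (h : IsIndefiniteIntegralOn G F (Icc a b)) (hab : a < b)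
    (hG : Tendsto (G a) (𝓝[>] a) (𝓝 L)) :
    Tendsto F (𝓝[>] a) (𝓝 (F a + (L - G a a))) := by
  have ha : a ∈ Icc a b := left_mem_Icc.2 hab.le
  have hb : b ∈ Icc a b := right_mem_Icc.2 hab.le
  suffices hlim : Tendsto (fun t => F t - F a - (G a t - G a a)) (𝓝[>] a) (𝓝 0) by
    convert hlim.add ((hG.sub_const (G a a)).const_add (F a)) using 2 <;> abel
  rw [Metric.tendsto_nhds]
  intro ε hε
  filter_upwards [(hasIntegralIcc_iff.1 ((h a ha b hb).1 hab.le) _ (half_pos hε)).eventually_nhdsGT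
    hab, Ioo_mem_nhdsGT hab] with t ht htab
  have := ((h t (Ioo_subset_Icc_self htab) b hb).1 htab.2.le).norm_sub_le htab.2.le ht
  rw [dist_zero_right, ← norm_neg]
  calc ‖-(F t - F a - (G a t - G a a))‖
      = ‖F b - F t - (F b - F a - (G a t - G a a))‖ := by congr 1; abel
    _ < ε := by linarith

theorem tendsto_nhdsLT (h : IsIndefiniteIntegralOn G F (Icc a b)) (hab : a < b)
    (hG : Tendsto (G b) (𝓝[<] b) (𝓝 L)) :
    Tendsto F (𝓝[<] b) (𝓝 (F b + (L - G b b))) := by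
  have h' := h.neg
  rw [neg_Icc] at h'
  have hlim := h'.tendsto_nhdsGT (neg_lt_neg hab) (L := L) (by
    simpa [Function.comp_def] using hG.comp tendsto_neg_nhdsGT_neg)
  simpa [Function.comp_def] using hlim.comp (tendsto_neg_nhdsLT (a := b))

end IsIndefiniteIntegralOn

end Kurzweil

section Regulated

variable {F : Type*} [NormedAddCommGroup F] {f : ℝ → F}

/-- A function on `ℝ` is regulated if it has one-sided limits at every point. -/
def IsRegulated (f : ℝ → F) : Prop :=
  ∀ t, (∃ l, Tendsto f (𝓝[<] t) (𝓝 l)) ∧ ∃ l, Tendsto f (𝓝[>] t) (𝓝 l)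

namespace IsRegulated

theorem comp_neg (hf : IsRegulated f) : IsRegulated fun t => f (-t) := fun t =>
  ⟨(hf (-t)).2.imp fun _ h => h.comp tendsto_neg_nhdsLT,
    (hf (-t)).1.imp fun _ h => h.comp tendsto_neg_nhdsGT⟩

theorem isBounded_image_Icc (hf : IsRegulated f) (a b : ℝ) :
    Bornology.IsBounded (f '' Icc a b) := by
  refine isCompact_Icc.induction_on (by simp) (fun s t hst ht => ht.subset (image_mono hst))
    (fun s t hs ht => by rw [image_union]; exact hs.union ht) fun t _ => ?_
  obtain ⟨⟨l, hl⟩, l', hl'⟩ := hf t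
  obtain ⟨s, hs, hsb⟩ := Metric.exists_isBounded_image_of_tendsto hl
  obtain ⟨s', hs', hsb'⟩ := Metric.exists_isBounded_image_of_tendsto hl'
  have hmem : insert t (s ∪ s') ∈ 𝓝 t := by
    rw [← nhdsNE_sup_pure, ← nhdsLT_sup_nhdsGT]
    exact ⟨⟨mem_of_superset hs fun r hr => .inr (.inl hr),
      mem_of_superset hs' fun r hr => .inr (.inr hr)⟩, mem_insert t _⟩
  refine ⟨_, mem_nhdsWithin_of_mem_nhds hmem, ?_⟩
  rw [image_insert_eq, image_union]
  exact (hsb.union hsb').insert _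

end IsRegulated

theorem boundedVariationOn_Icc (hf : LocallyBoundedVariationOn f univ) (a b : ℝ) :
    BoundedVariationOn f (Icc a b) := by
  simpa using hf a b trivial trivial

theorem isRegulated_of_locallyBoundedVariationOn [CompleteSpace F]
    (hf : LocallyBoundedVariationOn f univ) : IsRegulated f := fun t => by
  have hmem : Icc (t - 1) (t + 1) ∈ 𝓝 t := Icc_mem_nhds (by linarith) (by linarith)
  have hft := boundedVariationOn_Icc hf (t - 1) (t + 1)
  have hleft := hft.exists_tendsto_left t
  have hright := hft.exists_tendsto_right t
  rw [inter_comm, nhdsWithin_inter_of_mem' (mem_nhdsWithin_of_mem_nhds hmem)] at hleft hright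
  exact ⟨hleft, hright⟩

theorem eVariationOn_comp_neg_Icc (f : ℝ → F) (s t : ℝ) :
    eVariationOn (fun r => f (-r)) (Icc (-t) (-s)) = eVariationOn f (Icc s t) := by
  simpa [Function.comp_def] using eVariationOn.comp_eq_of_antitoneOn f (Neg.neg : ℝ → ℝ)
    (t := Icc (-t) (-s)) fun _ _ _ _ h => neg_le_neg h

theorem locallyBoundedVariationOn_comp_neg (hf : LocallyBoundedVariationOn f univ) :
    LocallyBoundedVariationOn (fun t => f (-t)) univ := fun a b _ _ => by
  rw [univ_inter, BoundedVariationOn, ← neg_neg a, ← neg_neg b, eVariationOn_comp_neg_Icc f]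
  exact boundedVariationOn_Icc hf (-b) (-a)

end Regulated

section Stieltjes

variable {R F : Type*} [NormedRing R] [NormedAddCommGroup F] [Module R F] [IsBoundedSMul R F]
  {A : ℝ → R} {f : ℝ → F} {a b c t : ℝ} {M ε : ℝ} {v S : F}

theorem toReal_eVariationOn_add (hA : BoundedVariationOn A (Icc a c)) (hab : a ≤ b) (hbc : b ≤ c) :
    (eVariationOn A (Icc a b)).toReal + (eVariationOn A (Icc b c)).toReal =
      (eVariationOn A (Icc a c)).toReal := by
  rw [← ENNReal.toReal_add (hA.mono (Icc_subset_Icc_right hbc)) (hA.mono (Icc_subset_Icc_left hab))]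
  simpa using congrArg ENNReal.toReal (eVariationOn.Icc_add_Icc A (s := univ) hab hbc (mem_univ b))

theorem FineSum.norm_le {δ : ℝ → ℝ} (h : FineSum (fun τ t => A t • f τ) δ a b S)
    (hA : BoundedVariationOn A (Icc a b)) (hf : ∀ τ ∈ Icc a b, ‖f τ‖ ≤ M) :
    ‖S‖ ≤ M * (eVariationOn A (Icc a b)).toReal := by
  induction h with
  | nil a => simp [eVariationOn.subsingleton]
  | @cons a c b τ S hac hτ _ h ih =>
    have hA' := hA.mono (Icc_subset_Icc_right h.le)
    have hincr : ‖A c - A a‖ ≤ (eVariationOn A (Icc a c)).toReal := by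
      rw [← dist_eq_norm]
      exact hA'.dist_le (right_mem_Icc.2 hac.le) (left_mem_Icc.2 hac.le)
    rw [← toReal_eVariationOn_add hA hac.le h.le, mul_add, ← sub_smul]
    refine norm_add_le_of_le ?_ (ih (hA.mono (Icc_subset_Icc_left hac.le))
      fun σ hσ => hf σ ⟨hac.le.trans hσ.1, hσ.2⟩)
    calc ‖(A c - A a) • f τ‖ ≤ ‖A c - A a‖ * ‖f τ‖ := norm_smul_le _ _
      _ ≤ (eVariationOn A (Icc a c)).toReal * M := by
        gcongr
        exact hf τ ⟨hτ.1, hτ.2.trans h.le⟩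
      _ = M * (eVariationOn A (Icc a c)).toReal := mul_comm _ _

theorem isApproxIntegral_zero (hA : BoundedVariationOn A (Icc a b))
    (hf : ∀ τ ∈ Icc a b, ‖f τ‖ ≤ M) :
    IsApproxIntegral (fun τ t => A t • f τ) a b 0 (M * (eVariationOn A (Icc a b)).toReal) :=
  ⟨fun _ => 1, fun _ _ => one_pos, fun S hS => by simpa using hS.norm_le hA hf⟩

theorem HasIntegralIcc.norm_le (hab : a ≤ b) (h : HasIntegralIcc (fun τ t => A t • f τ) a b v)
    (hA : BoundedVariationOn A (Icc a b)) (hf : ∀ τ ∈ Icc a b, ‖f τ‖ ≤ M) :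
    ‖v‖ ≤ M * (eVariationOn A (Icc a b)).toReal := by
  simpa using h.norm_sub_le hab (isApproxIntegral_zero hA hf)

/-- Near `t` the integrand is the constant `lim f(t+)`, up to a point mass at `t` and an error of
norm at most `ε`. -/
theorem eventually_nhdsGT_exists_isApproxIntegral (hA : LocallyBoundedVariationOn A univ)
    {B : R} {l : F} (hB : Tendsto A (𝓝[>] t) (𝓝 B)) (hl : Tendsto f (𝓝[>] t) (𝓝 l))
    (hε : 0 < ε) :
    ∀ᶠ s in 𝓝[>] t, ∃ v, IsApproxIntegral (fun τ t => A t • f τ) t s v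
      (ε * ((eVariationOn A (Icc t s)).toReal + (s - t))) := by
  have hnear : ∀ᶠ r in 𝓝[>] t, ‖f r - l‖ ≤ ε :=
    (tendsto_iff_norm_sub_tendsto_zero.1 hl).eventually_le_const hε
  filter_upwards [eventually_forall_Ioc hnear, self_mem_nhdsWithin] with s hs hts
  rw [mem_Ioi] at hts
  have hconst : IsApproxIntegral (fun _ r => A r • l) t s (A s • l - A t • l) 0 :=
    .of_eq fun S hS => hS.eq_sub
  have hpoint := hasIntegralIcc_iff.1 (HasIntegralIcc.pointMass_left hts (hB.smul_const (f t - l)))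
    (ε * (s - t)) (mul_pos hε (sub_pos.2 hts))
  have herr : IsApproxIntegral (fun τ r => A r • if τ = t then 0 else f τ - l) t s 0
      (ε * (eVariationOn A (Icc t s)).toReal) := by
    refine isApproxIntegral_zero (boundedVariationOn_Icc hA t s) fun τ hτ => ?_
    split_ifs with h
    · simpa using hε.le
    · exact hs τ ⟨hτ.1.lt_of_ne' h, hτ.2⟩
  refine ⟨_, (((hconst.add hpoint).add herr).congr_sub fun τ _ r _ u _ => ?_).mono
    (by rw [mul_add]; linarith)⟩
  rcases eq_or_ne τ t with rfl | h <;> simp [*, smul_sub]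

theorem eventually_nhdsLT_exists_isApproxIntegral (hA : LocallyBoundedVariationOn A univ) {B : R}
    {l : F} (hB : Tendsto A (𝓝[<] t) (𝓝 B)) (hl : Tendsto f (𝓝[<] t) (𝓝 l)) (hε : 0 < ε) :
    ∀ᶠ s in 𝓝[<] t, ∃ v, IsApproxIntegral (fun τ t => A t • f τ) s t v
      (ε * ((eVariationOn A (Icc s t)).toReal + (t - s))) := by
  have h := eventually_nhdsGT_exists_isApproxIntegral (t := -t)
    (locallyBoundedVariationOn_comp_neg hA) (hB.comp tendsto_neg_nhdsGT_neg)
    (hl.comp tendsto_neg_nhdsGT_neg) hε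
  filter_upwards [tendsto_neg_nhdsLT.eventually h] with s ⟨v, hv⟩
  rw [eVariationOn_comp_neg_Icc, neg_sub_neg] at hv
  exact ⟨-v, by simpa using hv.neg⟩

theorem IsRegulated.exists_hasIntegralIcc [CompleteSpace R] [CompleteSpace F] (hf : IsRegulated f)
    (hA : LocallyBoundedVariationOn A univ) (hab : a ≤ b) :
    ∃ v, HasIntegralIcc (fun τ t => A t • f τ) a b v := by
  refine HasIntegralIcc.exists_of_isApproxIntegral hab fun ε hε => ?_
  set V := (eVariationOn A (Icc a b)).toReal + (b - a)
  have hV : 0 ≤ V := add_nonneg ENNReal.toReal_nonneg (sub_nonneg.2 hab)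
  have hη : 0 < ε / (V + 1) := by positivity
  have hA' := isRegulated_of_locallyBoundedVariationOn hA
  set P : ℝ → ℝ → Prop := fun s t => ∃ v, IsApproxIntegral (fun τ t => A t • f τ) s t v
    (ε / (V + 1) * ((eVariationOn A (Icc s t)).toReal + (t - s)))
  suffices h : P a b from h.imp fun v hv => hv.mono <| by
    rw [div_mul_eq_mul_div, div_le_iff₀] <;> nlinarith
  refine interval_induction hab
    (fun t => ⟨0, by simpa using IsApproxIntegral.of_eq fun _ hS => hS.eq_zero⟩) ?_
    (fun t _ => ?_) fun t _ => ?_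
  · rintro r s t hrs hst ⟨v, hv⟩ ⟨w, hw⟩
    refine ⟨v + w, (hv.trans hrs hst hw).mono (le_of_eq ?_)⟩
    rw [← toReal_eVariationOn_add (boundedVariationOn_Icc hA r t) hrs hst]
    ring
  · obtain ⟨B, hB⟩ := (hA' t).2
    obtain ⟨l, hl⟩ := (hf t).2
    exact eventually_nhdsGT_exists_isApproxIntegral hA hB hl hη
  · obtain ⟨B, hB⟩ := (hA' t).1
    obtain ⟨l, hl⟩ := (hf t).1
    exact eventually_nhdsLT_exists_isApproxIntegral hA hB hl hη

end Stieltjes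

section Uniqueness

variable {R F : Type*} [NormedRing R] [NormedAddCommGroup F] [Module R F]
  {A : ℝ → R} {B : R} {f g x y : ℝ → F} {J : Set ℝ} {l : Filter ℝ} {a b c t M : ℝ} {v : F}

/-- `x` solves `dx/dτ = D[A(t)x]` on `J`. Coefficients in a normed ring `R` acting on `F` cover
both vector solutions and matrix solutions. -/
def SolvesOn (A : ℝ → R) (x : ℝ → F) (J : Set ℝ) : Prop :=
  IsIndefiniteIntegralOn (fun τ t => A t • x τ) x J

namespace SolvesOn

theorem sub (hx : SolvesOn A x J) (hy : SolvesOn A y J) : SolvesOn A (fun t => x t - y t) J := by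
  simpa only [SolvesOn, smul_sub] using IsIndefiniteIntegralOn.sub hx hy

theorem congr [J.OrdConnected] (hx : SolvesOn A x J) (hxy : EqOn x y J) : SolvesOn A y J :=
  IsIndefiniteIntegralOn.congr hx (fun τ hτ t _ => by rw [hxy hτ]) hxy

theorem neg (hx : SolvesOn A x J) : SolvesOn (fun t => A (-t)) (fun t => x (-t)) (-J) :=
  IsIndefiniteIntegralOn.neg hx

theorem exists_glue [J.OrdConnected] (hx : SolvesOn A x (J ∩ Iic b))
    (hy : SolvesOn A y (J ∩ Ici b)) (hb : b ∈ J) (hxy : x b = y b) :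
    ∃ z, EqOn z x (Iic b) ∧ EqOn z y (Ici b) ∧ SolvesOn A z J := by
  let z := fun t => if t ≤ b then x t else y t
  have hzx : EqOn z x (Iic b) := fun t ht => if_pos ht
  have hzy : EqOn z y (Ici b) := fun t ht => by
    rcases (mem_Ici.1 ht).eq_or_lt with rfl | hbt
    · rw [hzx self_mem_Iic, hxy]
    · exact if_neg hbt.not_ge
  refine ⟨z, hzx, hzy, .of_base (s := b) fun t ht => ?_⟩
  rcases le_total t b with htb | hbt
  · exact (hx.congr (hzx.symm.mono inter_subset_right)) b ⟨hb, self_mem_Iic⟩ t ⟨ht, htb⟩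
  · exact (hy.congr (hzy.symm.mono inter_subset_right)) b ⟨hb, self_mem_Ici⟩ t ⟨ht, hbt⟩

variable [IsBoundedSMul R F]

theorem tendsto_nhdsGT (hx : SolvesOn A x (Icc a b)) (hab : a < b)
    (hB : Tendsto A (𝓝[>] a) (𝓝 B)) : Tendsto x (𝓝[>] a) (𝓝 ((1 + (B - A a)) • x a)) := by
  simpa only [add_smul, one_smul, sub_smul] using
    IsIndefiniteIntegralOn.tendsto_nhdsGT hx hab (hB.smul_const (x a))

theorem tendsto_nhdsLT (hx : SolvesOn A x (Icc a b)) (hab : a < b)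
    (hB : Tendsto A (𝓝[<] b) (𝓝 B)) : Tendsto x (𝓝[<] b) (𝓝 ((1 + (B - A b)) • x b)) := by
  simpa only [add_smul, one_smul, sub_smul] using
    IsIndefiniteIntegralOn.tendsto_nhdsLT hx hab (hB.smul_const (x b))

end SolvesOn

variable [IsBoundedSMul R F]

/-- Halves a bound on the integrand: this one estimate drives both uniqueness and the Picard
iteration. The base value is a limit along `l` so as to allow a one-sided limit at an endpoint that
`J` excludes, where `A` may jump. -/
theorem IsIndefiniteIntegralOn.norm_sub_le_half [J.OrdConnected]
    (h : IsIndefiniteIntegralOn (fun τ t => A t • f τ) g J) (hA : eVariationOn A J ≤ 1 / 2)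
    (hf : ∀ τ ∈ J, ‖f τ‖ ≤ M) [l.NeBot] (hJ : J ∈ l) (hg : Tendsto g l (𝓝 v)) (ht : t ∈ J) :
    ‖g t - v‖ ≤ M / 2 := by
  have hM : 0 ≤ M := (norm_nonneg _).trans (hf t ht)
  have key : ∀ c ∈ J, ∀ d ∈ J, c ≤ d → ‖g d - g c‖ ≤ M / 2 := fun c hc d hd hcd => by
    have hsub : Icc c d ⊆ J := Set.Icc_subset J hc hd
    have hle : eVariationOn A (Icc c d) ≤ 1 / 2 := (eVariationOn.mono A hsub).trans hA
    refine (((h c hc d hd).1 hcd).norm_le hcd (ne_top_of_le_ne_top (by simp) hle)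
      fun τ hτ => hf τ (hsub hτ)).trans ?_
    have hreal : (eVariationOn A (Icc c d)).toReal ≤ 1 / 2 := by
      simpa using ENNReal.toReal_mono (by simp) hle
    nlinarith
  refine le_of_tendsto (hg.const_sub (g t)).norm (mem_of_superset hJ fun s hs => ?_)
  rcases le_total s t with hst | hts
  · exact key s hs t ht hst
  · exact (norm_sub_rev _ _).trans_le (key t ht s hs hts)

namespace SolvesOn

theorem eq_zero_of_eVariationOn_le [J.OrdConnected] (hx : SolvesOn A x J)
    (hA : eVariationOn A J ≤ 1 / 2) (hM : ∀ τ ∈ J, ‖x τ‖ ≤ M) [l.NeBot] (hJ : J ∈ l)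
    (h0 : Tendsto x l (𝓝 0)) (ht : t ∈ J) : x t = 0 := by
  have key : ∀ n : ℕ, ∀ τ ∈ J, ‖x τ‖ ≤ M * (1 / 2) ^ n := fun n => by
    induction n with
    | zero => simpa using hM
    | succ n ih =>
      intro τ hτ
      have := IsIndefiniteIntegralOn.norm_sub_le_half hx hA ih hJ h0 hτ
      rw [sub_zero] at this
      exact this.trans_eq (by ring)
  have hlim : Tendsto (fun n : ℕ => M * (1 / 2 : ℝ) ^ n) atTop (𝓝 0) := by
    simpa using (tendsto_pow_atTop_nhds_zero_of_lt_one one_half_pos.le one_half_lt_one).const_mul M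
  exact norm_le_zero_iff.1 (ge_of_tendsto' hlim fun n => key n t ht)

end SolvesOn

/-- Admissible coefficients: locally bounded variation and invertible jump factors `I + Δ⁺A` and
`I - Δ⁻A`. The latter is written as `1 + (A(t⁻) - A(t))`, which makes the condition visibly
invariant under time reversal. -/
structure Admissible (A : ℝ → R) : Prop where
  locallyBoundedVariationOn : LocallyBoundedVariationOn A univ
  isUnit_left : ∀ t, ∃ B, Tendsto A (𝓝[<] t) (𝓝 B) ∧ IsUnit (1 + (B - A t))
  isUnit_right : ∀ t, ∃ B, Tendsto A (𝓝[>] t) (𝓝 B) ∧ IsUnit (1 + (B - A t))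

theorem Admissible.comp_neg (hA : Admissible A) : Admissible fun t => A (-t) where
  locallyBoundedVariationOn := locallyBoundedVariationOn_comp_neg hA.locallyBoundedVariationOn
  isUnit_left t := (hA.isUnit_right (-t)).imp fun _ h => ⟨h.1.comp tendsto_neg_nhdsLT, h.2⟩
  isUnit_right t := (hA.isUnit_left (-t)).imp fun _ h => ⟨h.1.comp tendsto_neg_nhdsGT, h.2⟩

theorem eventually_eVariationOn_Ioc_le (hA : LocallyBoundedVariationOn A univ) (t : ℝ) :
    ∀ᶠ s in 𝓝[>] t, eVariationOn A (Ioc t s) ≤ 1 / 2 := by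
  have h := (boundedVariationOn_Icc hA t (t + 1)).tendsto_eVariationOn_Ioc_zero t
  have h' := (h.eventually_le_const (u := 1 / 2) (by simp)).filter_mono
    (nhdsWithin_mono t Ioc_subset_Icc_self)
  rw [nhdsWithin_Ioc_eq_nhdsGT (lt_add_one t)] at h'
  filter_upwards [h', Ioc_mem_nhdsGT (lt_add_one t)] with s hs hst
  have hsub : Ioc t s ⊆ Icc t (t + 1) := fun r hr => ⟨hr.1.le, hr.2.trans hst.2⟩
  rwa [inter_eq_right.2 hsub] at hs

namespace SolvesOn

/-- Invertibility of `I + Δ⁺A(a)` lets zeros propagate backwards across the jump at `a`. -/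
theorem eventually_nhdsGT_eq_zero (hA : Admissible A) (hx : SolvesOn A x (Icc a b)) (hab : a < b) :
    ∀ᶠ s in 𝓝[>] a, x a = 0 ∨ x s = 0 → ∀ r ∈ Icc a s, x r = 0 := by
  obtain ⟨B, hB, hunit⟩ := hA.isUnit_right a
  have hlim := hx.tendsto_nhdsGT hab hB
  have hbdd : ∀ᶠ r in 𝓝[>] a, ‖x r‖ ≤ ‖(1 + (B - A a)) • x a‖ + 1 :=
    hlim.norm.eventually_le_const (lt_add_one _)
  filter_upwards [eventually_forall_Ioc hbdd,
    eventually_eVariationOn_Ioc_le hA.locallyBoundedVariationOn a, Ioc_mem_nhdsGT hab]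
    with s hM hvar hs h0
  have hxs : SolvesOn A x (Ioc a s) :=
    IsIndefiniteIntegralOn.mono hx fun r hr => ⟨hr.1.le, hr.2.trans hs.2⟩
  have hIoc : ∀ r ∈ Ioc a s, x r = 0 := fun r hr => by
    rcases h0 with h0 | h0
    · rw [h0, smul_zero] at hlim
      exact hxs.eq_zero_of_eVariationOn_le hvar hM (Ioc_mem_nhdsGT hs.1) hlim hr
    · exact hxs.eq_zero_of_eVariationOn_le hvar hM (l := pure s) ⟨hs.1, le_rfl⟩
        (h0 ▸ tendsto_pure_nhds x s) hr
  have ha : (1 + (B - A a)) • x a = 0 := tendsto_nhds_unique_of_eventuallyEq hlim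
    tendsto_const_nhds (mem_of_superset (Ioc_mem_nhdsGT hs.1) hIoc)
  intro r hr
  rcases hr.1.eq_or_lt with rfl | har
  · exact hunit.smul_eq_zero.1 ha
  · exact hIoc r ⟨har, hr.2⟩

theorem eq_zero_on_Icc (hA : Admissible A) (hx : SolvesOn A x (Icc a b)) (hab : a ≤ b) :
    x a = 0 ∨ x b = 0 → ∀ t ∈ Icc a b, x t = 0 := by
  refine interval_induction (P := fun r s => x r = 0 ∨ x s = 0 → ∀ t ∈ Icc r s, x t = 0) hab
    (by simp) ?_ (fun t ht => ?_) fun t ht => ?_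
  · intro r s t hrs hst hr ht h0
    have hs : x s = 0 :=
      h0.elim (fun h => hr (.inl h) s ⟨hrs, le_rfl⟩) fun h => ht (.inr h) s ⟨le_rfl, hst⟩
    intro q hq
    rcases le_total q s with hqs | hsq
    · exact hr (.inr hs) q ⟨hq.1, hqs⟩
    · exact ht (.inl hs) q ⟨hsq, hq.2⟩
  · exact eventually_nhdsGT_eq_zero hA (IsIndefiniteIntegralOn.mono hx (Icc_subset_Icc_left ht.1))
      ht.2
  · have hx' := hx.neg
    rw [neg_Icc] at hx'
    filter_upwards [tendsto_neg_nhdsLT.eventually (eventually_nhdsGT_eq_zero hA.comp_neg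
      (IsIndefiniteIntegralOn.mono hx' (Icc_subset_Icc_left (neg_le_neg ht.2))) (neg_lt_neg ht.1))]
      with s hs h0 r hr
    simpa using hs (by simpa using h0.symm) (-r) ⟨neg_le_neg hr.2, neg_le_neg hr.1⟩

theorem eqOn [J.OrdConnected] (hA : Admissible A) (hx : SolvesOn A x J) (hy : SolvesOn A y J)
    (hc : c ∈ J) (hxy : x c = y c) : EqOn x y J := fun t ht => by
  have hz := hx.sub hy
  rcases le_total c t with hct | htc
  · exact sub_eq_zero.1 (eq_zero_on_Icc hA (hz.mono (Set.Icc_subset J hc ht)) hct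
      (.inl (sub_eq_zero.2 hxy)) t ⟨hct, le_rfl⟩)
  · exact sub_eq_zero.1 (eq_zero_on_Icc hA (hz.mono (Set.Icc_subset J ht hc)) htc
      (.inr (sub_eq_zero.2 hxy)) t ⟨le_rfl, htc⟩)

end SolvesOn

end Uniqueness

section Existence

variable {F : Type*} [NormedAddCommGroup F] {f : ℝ → F} {J : Set ℝ} {t : ℝ} {v : F}

theorem eventually_mem_or_eventually_notMem_nhdsGT (hJ : J.OrdConnected) (t : ℝ) :
    (∀ᶠ s in 𝓝[>] t, s ∈ J) ∨ ∀ᶠ s in 𝓝[>] t, s ∉ J := by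
  refine or_iff_not_imp_right.2 fun h => ?_
  have hfreq : ∃ᶠ s in 𝓝[>] t, s ∈ J := h ∘ id
  obtain ⟨u, hu, htu⟩ := (hfreq.and_eventually eventually_mem_nhdsWithin).exists
  filter_upwards [Ioc_mem_nhdsGT htu] with r hr
  obtain ⟨s, hs, hsr⟩ := (hfreq.and_eventually (Ioc_mem_nhdsGT hr.1)).exists
  exact hJ.out hs hu ⟨hsr.2, hr.2⟩

theorem exists_tendsto_indicator_nhdsGT (hJ : J.OrdConnected)
    (hf : ∃ L, Tendsto f (𝓝[>] t) (𝓝 L)) :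
    ∃ L, Tendsto (J.indicator f) (𝓝[>] t) (𝓝 L) := by
  rcases eventually_mem_or_eventually_notMem_nhdsGT hJ t with h | h
  · exact hf.imp fun L hL => hL.congr' (h.mono fun s hs => (indicator_of_mem hs f).symm)
  · exact ⟨0, tendsto_const_nhds.congr' (h.mono fun s hs => (indicator_of_notMem hs f).symm)⟩

theorem isRegulated_zero : IsRegulated (0 : ℝ → F) :=
  fun _ => ⟨⟨0, tendsto_const_nhds⟩, 0, tendsto_const_nhds⟩

theorem IsRegulated.indicator (hf : IsRegulated f) (hJ : J.OrdConnected) :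
    IsRegulated (J.indicator f) := fun t => by
  refine ⟨?_, exists_tendsto_indicator_nhdsGT hJ (hf t).2⟩
  have hJ' : (-J).OrdConnected := hJ.preimage_anti fun _ _ h => neg_le_neg h
  obtain ⟨L, hL⟩ := exists_tendsto_indicator_nhdsGT hJ' (hf.comp_neg (-t)).2
  refine ⟨L, ?_⟩
  convert hL.comp tendsto_neg_nhdsLT using 1
  ext r
  by_cases hr : r ∈ J <;> simp [hr]

theorem IsRegulated.update (hf : IsRegulated f) (t : ℝ) (v : F) :
    IsRegulated (Function.update f t v) := fun s => by
  have hne : ∀ᶠ r in 𝓝[≠] s, f r = Function.update f t v r := by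
    filter_upwards [nhdsNE_le_cofinite s (finite_singleton t).compl_mem_cofinite] with r hr
    exact (Function.update_of_ne hr v f).symm
  exact ⟨(hf s).1.imp fun L hL => hL.congr' (hne.filter_mono (nhdsLT_le_nhdsNE s)),
    (hf s).2.imp fun L hL => hL.congr' (hne.filter_mono (nhdsGT_le_nhdsNE s))⟩

theorem isClosed_setOf_exists_tendsto [CompleteSpace F] (l : Filter ℝ) [l.NeBot] :
    IsClosed {f : UniformFun ℝ F | ∃ L, Tendsto (UniformFun.toFun f) l (𝓝 L)} := by
  refine isClosed_of_closure_subset fun f hf => ?_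
  rw [EMetric.mem_closure_iff] at hf
  rw [Set.mem_ofPred_eq, ← cauchy_map_iff_exists_tendsto, EMetric.cauchy_iff]
  refine ⟨(‹l.NeBot›.map _).ne, fun ε hε => ?_⟩
  have hε3 : 0 < ε / 3 := ENNReal.div_pos hε.ne' (by simp)
  obtain ⟨g, ⟨L, hL⟩, hfg⟩ := hf (ε / 3) hε3
  obtain ⟨T, hT, hd⟩ := (EMetric.cauchy_iff.1 hL.cauchy_map).2 (ε / 3) hε3
  refine ⟨UniformFun.toFun f '' (UniformFun.toFun g ⁻¹' T), image_mem_map hT, ?_⟩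
  rintro _ ⟨r, hr, rfl⟩ _ ⟨s, hs, rfl⟩
  calc edist (UniformFun.toFun f r) (UniformFun.toFun f s)
      ≤ edist (UniformFun.toFun f r) (UniformFun.toFun g r)
        + edist (UniformFun.toFun g r) (UniformFun.toFun g s)
        + edist (UniformFun.toFun g s) (UniformFun.toFun f s) := edist_triangle4 _ _ _ _
    _ < ε / 3 + ε / 3 + ε / 3 := by
      refine ENNReal.add_lt_add (ENNReal.add_lt_add (UniformFun.edist_eval_le.trans_lt hfg)
        (hd _ hr _ hs)) ?_
      rw [edist_comm]
      exact UniformFun.edist_eval_le.trans_lt hfg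
    _ = ε := ENNReal.add_thirds ε

theorem isClosed_setOf_isRegulated [CompleteSpace F] :
    IsClosed {f : UniformFun ℝ F | IsRegulated (UniformFun.toFun f)} := by
  simp only [IsRegulated, Set.ofPred_forall, Set.ofPred_and]
  exact isClosed_iInter fun t =>
    (isClosed_setOf_exists_tendsto _).inter (isClosed_setOf_exists_tendsto _)

/-- Banach's fixed point theorem for regulated functions in the uniform metric. -/
theorem IsRegulated.exists_fixedPoint [CompleteSpace F] {Ψ : (ℝ → F) → ℝ → F} {M : ℝ}
    (hreg : ∀ f, IsRegulated f → IsRegulated (Ψ f))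
    (hhalf : ∀ f g, IsRegulated f → IsRegulated g → ∀ M, (∀ t, ‖f t - g t‖ ≤ M) →
      ∀ t, ‖Ψ f t - Ψ g t‖ ≤ M / 2)
    (h0 : ∀ t, ‖Ψ 0 t‖ ≤ M) : ∃ x, IsRegulated x ∧ Ψ x = x := by
  let S := {f : UniformFun ℝ F | IsRegulated (UniformFun.toFun f)}
  have hS : CompleteSpace S := isClosed_setOf_isRegulated.completeSpace_coe
  let T : S → S := fun f => ⟨UniformFun.ofFun (Ψ (UniformFun.toFun f.1)), hreg _ f.2⟩
  have hT : ContractingWith (1 / 2) T := by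
    refine ⟨NNReal.half_lt_self one_ne_zero, fun f g => ?_⟩
    rcases eq_or_ne (edist f g) ⊤ with htop | htop
    · simp [htop]
    have hfg : ∀ t, ‖UniformFun.toFun f.1 t - UniformFun.toFun g.1 t‖ ≤ (edist f g).toReal :=
      fun t => by
        rw [← dist_eq_norm, dist_edist]
        exact ENNReal.toReal_mono htop UniformFun.edist_eval_le
    refine UniformFun.edist_le.2 fun t => ?_
    rw [edist_dist, dist_eq_norm]
    refine (ENNReal.ofReal_le_ofReal (hhalf _ _ f.2 g.2 _ hfg t)).trans_eq ?_
    rw [ENNReal.ofReal_div_of_pos two_pos, ENNReal.ofReal_toReal htop]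
    simp [ENNReal.div_eq_inv_mul]
  let z : S := ⟨UniformFun.ofFun 0, isRegulated_zero⟩
  have hdist : edist z (T z) ≠ ⊤ := by
    refine ne_top_of_le_ne_top (ENNReal.ofReal_ne_top (r := M)) (UniformFun.edist_le.2 fun t => ?_)
    rw [edist_dist, dist_comm]
    simpa [T, z] using ENNReal.ofReal_le_ofReal (h0 t)
  obtain ⟨x, hx, -⟩ := hT.exists_fixedPoint _ hdist
  exact ⟨UniformFun.toFun x.1, x.2, congrArg (fun f : S => UniformFun.toFun f.1) hx⟩

variable {R : Type*} [NormedRing R] [Module R F] [IsBoundedSMul R F] {A : ℝ → R} {B : R}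
  {x : ℝ → F} {l : Filter ℝ} {a b : ℝ}

theorem IsIndefiniteIntegralOn.isRegulated (hA : IsRegulated A)
    (h : IsIndefiniteIntegralOn (fun τ t => A t • f τ) x univ) : IsRegulated x := fun t => by
  obtain ⟨⟨B, hB⟩, B', hB'⟩ := hA t
  exact ⟨⟨_, (h.mono (subset_univ _)).tendsto_nhdsLT (sub_one_lt t) (hB.smul_const (f t))⟩,
    _, (h.mono (subset_univ _)).tendsto_nhdsGT (lt_add_one t) (hB'.smul_const (f t))⟩

variable [CompleteSpace R] [CompleteSpace F]

theorem IsRegulated.exists_isIndefiniteIntegralOn (hf : IsRegulated f)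
    (hA : LocallyBoundedVariationOn A univ) (s : ℝ) (v : F) :
    ∃ x, x s = v ∧ IsIndefiniteIntegralOn (fun τ t => A t • f τ) x univ := by
  have key : ∀ t, ∃ w, HasIntegral (fun τ t => A t • f τ) s t w := fun t => by
    rcases le_total s t with hst | hts
    · exact (hf.exists_hasIntegralIcc hA hst).imp fun _ => .of_le hst
    · obtain ⟨w, hw⟩ := hf.exists_hasIntegralIcc hA hts
      exact ⟨-w, (HasIntegral.of_le hts hw).symm⟩
  choose g hg using key
  refine ⟨fun t => v + g t, by simp [(hg s).eq_zero], .of_base (s := s) fun t _ => ?_⟩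
  simpa [(hg s).eq_zero] using hg t

theorem IsRegulated.exists_isIndefiniteIntegralOn_tendsto (hf : IsRegulated f)
    (hA : LocallyBoundedVariationOn A univ)
    (hl : ∀ g : ℝ → F, IsRegulated g → ∃ w, Tendsto g l (𝓝 w)) (v : F) :
    ∃ x, IsRegulated x ∧ Tendsto x l (𝓝 v) ∧
      IsIndefiniteIntegralOn (fun τ t => A t • f τ) x univ := by
  obtain ⟨g, -, hg⟩ := hf.exists_isIndefiniteIntegralOn hA 0 0
  obtain ⟨w, hw⟩ := hl g (hg.isRegulated (isRegulated_of_locallyBoundedVariationOn hA))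
  have hx : IsIndefiniteIntegralOn (fun τ t => A t • f τ) (fun t => g t + (v - w)) univ :=
    fun c hc d hd => by simpa using hg c hc d hd
  refine ⟨_, hx.isRegulated (isRegulated_of_locallyBoundedVariationOn hA), ?_, hx⟩
  simpa using hw.add_const (v - w)

/-- Picard iteration for `f ↦ v + ∫ d[A] f`, cut off outside `J`. -/
theorem exists_solvesOn_of_eVariationOn_le (hA : LocallyBoundedVariationOn A univ)
    (hJ : J.OrdConnected) (hvar : eVariationOn A J ≤ 1 / 2) [l.NeBot] (hJl : J ∈ l)
    (hl : ∀ g : ℝ → F, IsRegulated g → ∃ w, Tendsto g l (𝓝 w)) (v : F) :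
    ∃ x, IsRegulated x ∧ Tendsto x l (𝓝 v) ∧ SolvesOn A x J := by
  choose! Φ hreg hlim hΦ using fun (f : ℝ → F) (hf : IsRegulated f) =>
    hf.exists_isIndefiniteIntegralOn_tendsto hA hl v
  have hhalf : ∀ f g, IsRegulated f → IsRegulated g → ∀ M, (∀ t, ‖f t - g t‖ ≤ M) →
      ∀ t, ‖J.indicator (Φ f) t - J.indicator (Φ g) t‖ ≤ M / 2 := fun f g hf hg M hM t => by
    have hint : IsIndefiniteIntegralOn (fun τ t => A t • (f τ - g τ))
        (fun t => Φ f t - Φ g t) J := by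
      simpa only [smul_sub] using ((hΦ f hf).sub (hΦ g hg)).mono (subset_univ J)
    have hlim' := (hlim f hf).sub (hlim g hg)
    rw [sub_self] at hlim'
    by_cases ht : t ∈ J
    · simpa [ht] using hint.norm_sub_le_half hvar (fun τ _ => hM τ) hJl hlim' ht
    · simpa [ht] using div_nonneg ((norm_nonneg _).trans (hM t)) zero_le_two
  have hbase : ∀ t, ‖J.indicator (Φ 0) t‖ ≤ ‖v‖ := fun t => by
    by_cases ht : t ∈ J
    · have := ((hΦ 0 isRegulated_zero).mono (subset_univ J)).norm_sub_le_half hvar (M := 0)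
        (by simp) hJl (hlim 0 isRegulated_zero) ht
      rw [zero_div, norm_le_zero_iff, sub_eq_zero] at this
      simp [ht, this]
    · simp [ht]
  obtain ⟨x, hx, hfix⟩ := IsRegulated.exists_fixedPoint
    (fun f hf => (hreg f hf).indicator hJ) hhalf hbase
  have hΦx : EqOn (Φ x) x J := fun t ht => by rw [← indicator_of_mem ht (Φ x), hfix]
  exact ⟨x, hx, (hlim x hx).congr' (mem_of_superset hJl hΦx),
    ((hΦ x hx).mono (subset_univ J)).congr (fun _ _ _ _ => rfl) hΦx⟩

theorem SolvesOn.update_left (hA : LocallyBoundedVariationOn A univ)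
    (hx : SolvesOn A x (Ioc a b)) (hreg : IsRegulated x) (hab : a < b)
    (hB : Tendsto A (𝓝[>] a) (𝓝 B)) (hlim : Tendsto x (𝓝[>] a) (𝓝 ((1 + (B - A a)) • v))) :
    SolvesOn A (Function.update x a v) (Icc a b) := by
  set y := Function.update x a v
  have hyx : ∀ t ∈ Ioc a b, y t = x t := fun t ht => Function.update_of_ne ht.1.ne' v x
  obtain ⟨g, hgb, hg⟩ := (hreg.update a v).exists_isIndefiniteIntegralOn hA b (x b)
  have hgx : EqOn g x (Ioc a b) := fun t ht => by
    have hgIoc : IsIndefiniteIntegralOn (fun τ t => A t • x τ) g (Ioc a b) :=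
      (hg.mono (subset_univ _)).congr (fun τ hτ t _ => by rw [← hyx τ hτ]) fun _ _ => rfl
    have hb : b ∈ Ioc a b := ⟨hab, le_rfl⟩
    have := ((hgIoc t ht b hb).1 ht.2).unique ht.2 ((hx t ht b hb).1 ht.2)
    rwa [hgb, sub_right_inj] at this
  have hga : g a = v := by
    have hglim := (hg.mono (subset_univ _)).tendsto_nhdsGT hab
      (hB.smul_const (Function.update x a v a))
    have := tendsto_nhds_unique_of_eventuallyEq hglim hlim
      (mem_of_superset (Ioc_mem_nhdsGT hab) hgx)
    rwa [show Function.update x a v a = v from Function.update_self a v x, ← sub_smul, add_smul,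
      one_smul, add_left_inj] at this
  refine (hg.mono (subset_univ _)).congr (fun _ _ _ _ => rfl) fun t ht => ?_
  rcases ht.1.eq_or_lt with rfl | hat
  · simpa [y] using hga
  · rw [hgx ⟨hat, ht.2⟩, hyx t ⟨hat, ht.2⟩]

theorem eventually_nhdsGT_exists_solvesOn (hA : Admissible A) (a : ℝ) :
    ∀ᶠ b in 𝓝[>] a, ∀ v : F, (∃ x, x a = v ∧ SolvesOn A x (Icc a b)) ∧
      ∃ x, x b = v ∧ SolvesOn A x (Icc a b) := by
  obtain ⟨B, hB, u, hu⟩ := hA.isUnit_right a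
  have hbv := hA.locallyBoundedVariationOn
  filter_upwards [eventually_eVariationOn_Ioc_le hbv a, self_mem_nhdsWithin] with b hvar hab v
  constructor
  · obtain ⟨x, hreg, hlim, hx⟩ := exists_solvesOn_of_eVariationOn_le hbv ordConnected_Ioc hvar
      (Ioc_mem_nhdsGT hab) (fun g hg => (hg a).2) ((1 + (B - A a)) • v)
    exact ⟨_, Function.update_self a v x, hx.update_left hbv hreg hab hB hlim⟩
  · obtain ⟨x, hreg, hlim, hx⟩ := exists_solvesOn_of_eVariationOn_le hbv ordConnected_Ioc hvar
      (l := pure b) (right_mem_Ioc.2 hab) (fun g _ => ⟨g b, tendsto_pure_nhds g b⟩) v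
    obtain ⟨L, hL⟩ := (hreg a).2
    have hjump : (1 + (B - A a)) • (↑u⁻¹ : R) • L = L := by
      rw [← hu, ← mul_smul, u.mul_inv, one_smul]
    refine ⟨_, ?_, hx.update_left hbv hreg hab hB (hjump.symm ▸ hL)⟩
    rw [Function.update_of_ne (ne_of_gt hab)]
    exact tendsto_nhds_unique (tendsto_pure_nhds x b) hlim

theorem eventually_nhdsLT_exists_solvesOn (hA : Admissible A) (b : ℝ) :
    ∀ᶠ a in 𝓝[<] b, ∀ v : F, (∃ x, x a = v ∧ SolvesOn A x (Icc a b)) ∧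
      ∃ x, x b = v ∧ SolvesOn A x (Icc a b) := by
  filter_upwards [tendsto_neg_nhdsLT.eventually
    (eventually_nhdsGT_exists_solvesOn (F := F) hA.comp_neg (-b))] with a ha v
  have hreflect : ∀ x : ℝ → F, SolvesOn (fun t => A (-t)) x (Icc (-b) (-a)) →
      SolvesOn A (fun r => x (-r)) (Icc a b) := fun x hx => by simpa using hx.neg
  obtain ⟨⟨x, hxb, hx⟩, y, hya, hy⟩ := ha v
  exact ⟨⟨_, hya, hreflect y hy⟩, _, hxb, hreflect x hx⟩

theorem exists_solvesOn_Icc (hA : Admissible A) (hab : a ≤ b) (v : F) :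
    (∃ x, x a = v ∧ SolvesOn A x (Icc a b)) ∧ ∃ x, x b = v ∧ SolvesOn A x (Icc a b) := by
  suffices h : ∀ v : F, (∃ x, x a = v ∧ SolvesOn A x (Icc a b)) ∧
      ∃ x, x b = v ∧ SolvesOn A x (Icc a b) from h v
  refine interval_induction (P := fun s t => ∀ v : F, (∃ x, x s = v ∧ SolvesOn A x (Icc s t)) ∧
    ∃ x, x t = v ∧ SolvesOn A x (Icc s t)) hab (fun t v => ?_) ?_
    (fun t _ => eventually_nhdsGT_exists_solvesOn hA t)
    fun t _ => eventually_nhdsLT_exists_solvesOn hA t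
  · have h : SolvesOn A (fun _ => v) (Icc t t) := by
      rw [Icc_self]
      rintro c rfl d rfl
      exact .of_le le_rfl (.of_eq fun S hS => by simpa using hS.eq_zero)
    exact ⟨⟨_, rfl, h⟩, _, rfl, h⟩
  · intro r s t hrs hst hr ht v
    have hglue : ∀ x y : ℝ → F, SolvesOn A x (Icc r s) → SolvesOn A y (Icc s t) → x s = y s →
        ∃ z, EqOn z x (Iic s) ∧ EqOn z y (Ici s) ∧ SolvesOn A z (Icc r t) := fun x y hx hy hxy =>
      SolvesOn.exists_glue (hx.mono fun q hq => ⟨hq.1.1, hq.2⟩)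
        (hy.mono fun q hq => ⟨hq.2, hq.1.2⟩) ⟨hrs, hst⟩ hxy
    constructor
    · obtain ⟨x, hxr, hx⟩ := (hr v).1
      obtain ⟨y, hys, hy⟩ := (ht (x s)).1
      obtain ⟨z, hzx, -, hz⟩ := hglue x y hx hy hys.symm
      exact ⟨z, (hzx hrs).trans hxr, hz⟩
    · obtain ⟨y, hyt, hy⟩ := (ht v).2
      obtain ⟨x, hxs, hx⟩ := (hr (y s)).2
      obtain ⟨z, -, hzy, hz⟩ := hglue x y hx hy hxs
      exact ⟨z, (hzy hst).trans hyt, hz⟩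

theorem exists_solvesOn_univ (hA : Admissible A) (c : ℝ) (v : F) :
    ∃ x, x c = v ∧ SolvesOn A x univ := by
  have hball : ∀ n : ℕ, ∃ x : ℝ → F, x c = v ∧ SolvesOn A x (Icc (c - n) (c + n)) := fun n => by
    have hn : (0 : ℝ) ≤ n := n.cast_nonneg
    obtain ⟨x, hxc, hx⟩ := (exists_solvesOn_Icc hA (sub_le_self c hn) v).2
    obtain ⟨y, hyc, hy⟩ := (exists_solvesOn_Icc hA (le_add_of_nonneg_right hn) v).1
    obtain ⟨z, hzx, -, hz⟩ := SolvesOn.exists_glue (J := Icc (c - n) (c + n))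
      (hx.mono fun q hq => ⟨hq.1.1, hq.2⟩) (hy.mono fun q hq => ⟨hq.2, hq.1.2⟩)
      ⟨sub_le_self c hn, le_add_of_nonneg_right hn⟩ (hxc.trans hyc.symm)
    exact ⟨z, (hzx self_mem_Iic).trans hxc, hz⟩
  choose x hxc hx using hball
  have hmem : ∀ {t : ℝ} {n : ℕ}, |t - c| ≤ n ↔ t ∈ Icc (c - n) (c + n) := fun {t n} => by
    rw [abs_le, mem_Icc, neg_le_sub_iff_le_add, sub_le_iff_le_add', sub_le_iff_le_add]
  have hagree : ∀ n : ℕ, EqOn (x n) (fun t => x ⌈|t - c|⌉₊ t) (Icc (c - n) (c + n)) :=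
    fun n t ht => by
      have hle : (⌈|t - c|⌉₊ : ℝ) ≤ n := by exact_mod_cast Nat.ceil_le.2 (hmem.2 ht)
      have hxn : SolvesOn A (x n) (Icc (c - ⌈|t - c|⌉₊) (c + ⌈|t - c|⌉₊)) :=
        (hx n).mono (Icc_subset_Icc (by linarith) (by linarith))
      exact hxn.eqOn hA (hx _) (hmem.1 (by simp)) ((hxc n).trans (hxc _).symm)
        (hmem.1 (Nat.le_ceil _))
  refine ⟨fun t => x ⌈|t - c|⌉₊ t, hxc _, .of_base (s := c) fun t _ => ?_⟩
  exact ((hx ⌈|t - c|⌉₊).congr (hagree _)) c (hmem.1 (by simp)) t (hmem.1 (Nat.le_ceil _))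

end Existence

section Floquet

variable {R : Type*} [NormedRing R] {U : ℝ → ℝ → R} {ω s t : ℝ}

/-- An evolution family on `[0, ∞)` invariant under translation by `ω` in both variables. -/
structure IsPeriodicEvolution (U : ℝ → ℝ → R) (ω : ℝ) : Prop where
  self : ∀ t ≥ 0, U t t = 1
  mul : ∀ t ≥ 0, ∀ s ≥ 0, ∀ r ≥ 0, U t s * U s r = U t r
  add_period : ∀ t ≥ 0, ∀ s ≥ 0, U (t + ω) (s + ω) = U t s

/-- Uniform exponential decay of a two-parameter family on `0 ≤ s ≤ t`. -/
def HasUniformExpDecay (U : ℝ → ℝ → R) : Prop :=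
  ∃ α > 0, ∃ K > 0, ∀ s ≥ 0, ∀ t ≥ s, ‖U t s‖ ≤ K * Real.exp (-α * (t - s))

theorem exists_eq_add_nat_mul (hω : 0 < ω) (ht : 0 ≤ t) :
    ∃ k : ℕ, ∃ r ∈ Icc 0 ω, t = r + k * ω := by
  have hle := Nat.floor_le (div_nonneg ht hω.le)
  have hlt := Nat.lt_floor_add_one (t / ω)
  rw [le_div_iff₀ hω] at hle
  rw [div_lt_iff₀ hω] at hlt
  exact ⟨⌊t / ω⌋₊, t - ⌊t / ω⌋₊ * ω, ⟨by linarith, by linarith⟩, by ring⟩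

theorem exp_neg_one_pow_le (hω : 0 < ω) (hst : t - s ≤ ω) (k : ℕ) :
    Real.exp (-1) ^ k ≤ Real.exp 1 * Real.exp (-ω⁻¹ * (t + k * ω - s)) := by
  have hle : ω⁻¹ * (t - s) ≤ 1 := by rwa [inv_mul_le_iff₀ hω, mul_one]
  have heq : -ω⁻¹ * (t + k * ω - s) = -(ω⁻¹ * (t - s)) - k := by
    field_simp
    ring
  rw [← Real.exp_nat_mul, ← Real.exp_add, heq]
  gcongr
  linarith

theorem norm_pow_mul_le (a b : R) (k : ℕ) : ‖a ^ k * b‖ ≤ ‖a‖ ^ k * ‖b‖ := by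
  induction k with
  | zero => simp
  | succ k ih =>
    rw [pow_succ', pow_succ', mul_assoc, mul_assoc]
    exact (norm_mul_le _ _).trans (mul_le_mul_of_nonneg_left ih (norm_nonneg a))

namespace IsPeriodicEvolution

theorem nat_mul (hU : IsPeriodicEvolution U ω) (hω : 0 ≤ ω) (k : ℕ) :
    IsPeriodicEvolution U (k * ω) where
  self := hU.self
  mul := hU.mul
  add_period t ht s hs := by
    induction k with
    | zero => simp
    | succ k ih =>
      have hk : (0 : ℝ) ≤ k * ω := by positivity
      have := hU.add_period (t + k * ω) (add_nonneg ht hk) (s + k * ω) (add_nonneg hs hk)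
      rwa [ih, add_assoc, add_assoc, ← add_one_mul, ← Nat.cast_succ] at this

theorem nat_mul_zero_eq_pow (hU : IsPeriodicEvolution U ω) (hω : 0 ≤ ω) (k : ℕ) :
    U (k * ω) 0 = U ω 0 ^ k := by
  induction k with
  | zero => simpa using hU.self 0 le_rfl
  | succ k ih =>
    have hk : (0 : ℝ) ≤ k * ω := by positivity
    have hper := hU.add_period (k * ω) hk 0 le_rfl
    rw [zero_add, ih, ← add_one_mul, ← Nat.cast_succ] at hper
    rw [← hU.mul _ (by positivity) ω hω 0 le_rfl, hper, pow_succ]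

theorem add_nat_mul_eq (hU : IsPeriodicEvolution U ω) (hω : 0 ≤ ω) (ht : 0 ≤ t) (hs : 0 ≤ s)
    (k : ℕ) : U (t + k * ω) s = U t 0 * (U ω 0 ^ k * U 0 s) := by
  have hk : (0 : ℝ) ≤ k * ω := by positivity
  have hper := (hU.nat_mul hω k).add_period t ht 0 le_rfl
  rw [zero_add] at hper
  rw [← hU.nat_mul_zero_eq_pow hω k, hU.mul _ hk 0 le_rfl s hs, ← hper,
    hU.mul _ (add_nonneg ht hk) _ hk s hs]

theorem hasUniformExpDecay_of_norm_le (hU : IsPeriodicEvolution U ω) (hω : 0 < ω)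
    (hleft : Bornology.IsBounded ((U · 0) '' Icc 0 ω))
    (hright : Bornology.IsBounded (U 0 '' Icc 0 ω)) (hX : ‖U ω 0‖ ≤ Real.exp (-1)) :
    HasUniformExpDecay U := by
  obtain ⟨M, hM, hbound⟩ := (hleft.union hright).exists_pos_norm_le
  have hMl : ∀ r ∈ Icc 0 ω, ‖U r 0‖ ≤ M := fun r hr => hbound _ (.inl ⟨r, hr, rfl⟩)
  have hMr : ∀ r ∈ Icc 0 ω, ‖U 0 r‖ ≤ M := fun r hr => hbound _ (.inr ⟨r, hr, rfl⟩)
  have hbase : ∀ s ∈ Icc 0 ω, ∀ t ≥ s,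
      ‖U t s‖ ≤ M * Real.exp 1 * M * Real.exp (-ω⁻¹ * (t - s)) := fun s hs t hst => by
    obtain ⟨k, r, hr, rfl⟩ := exists_eq_add_nat_mul hω (hs.1.trans hst)
    have hexp := (pow_le_pow_left₀ (norm_nonneg _) hX k).trans
      (exp_neg_one_pow_le hω (show r - s ≤ ω by linarith [hr.2, hs.1]) k)
    rw [hU.add_nat_mul_eq hω.le hr.1 hs.1]
    calc ‖U r 0 * (U ω 0 ^ k * U 0 s)‖ ≤ ‖U r 0‖ * (‖U ω 0‖ ^ k * ‖U 0 s‖) :=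
          (norm_mul_le _ _).trans (by gcongr; exact norm_pow_mul_le _ _ k)
      _ ≤ M * (Real.exp 1 * Real.exp (-ω⁻¹ * (r + k * ω - s)) * M) := by
          gcongr
          exacts [hMl r hr, hMr s hs]
      _ = _ := by ring
  refine ⟨ω⁻¹, inv_pos.2 hω, M * Real.exp 1 * M, by positivity, fun s hs t hst => ?_⟩
  obtain ⟨k, r, hr, rfl⟩ := exists_eq_add_nat_mul hω hs
  have hper := (hU.nat_mul hω.le k).add_period (t - k * ω) (by linarith [hr.1]) r hr.1
  rw [sub_add_cancel] at hper
  rw [hper, add_comm r, ← sub_sub]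
  exact hbase r hr _ (by linarith)

/-- If some power of the monodromy `U ω 0` is small, then the corresponding multiple of `ω` is a
period whose monodromy is small. -/
theorem hasUniformExpDecay_iff_tendsto_pow (hU : IsPeriodicEvolution U ω) (hω : 0 < ω)
    (hleft : ∀ b, Bornology.IsBounded ((U · 0) '' Icc 0 b))
    (hright : ∀ b, Bornology.IsBounded (U 0 '' Icc 0 b)) :
    HasUniformExpDecay U ↔ Tendsto (fun k : ℕ => U ω 0 ^ k) atTop (𝓝 0) := by
  constructor
  · rintro ⟨α, hα, K, -, hdecay⟩
    have hlim : Tendsto (fun k : ℕ => K * Real.exp (-(α * ω)) ^ k) atTop (𝓝 0) := by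
      simpa using (tendsto_pow_atTop_nhds_zero_of_lt_one (Real.exp_pos _).le
        (Real.exp_lt_one_iff.2 (neg_neg_of_pos (mul_pos hα hω)))).const_mul K
    refine squeeze_zero_norm (fun k => ?_) hlim
    rw [← hU.nat_mul_zero_eq_pow hω.le, ← Real.exp_nat_mul]
    refine (hdecay 0 le_rfl (k * ω) (by positivity)).trans_eq ?_
    ring_nf
  · intro h
    have hsmall : ∀ᶠ k : ℕ in atTop, ‖U ω 0 ^ k‖ < Real.exp (-1) :=
      h.norm.eventually_lt_const (by simpa using Real.exp_pos _)
    obtain ⟨k, hX, hk⟩ := (hsmall.and (eventually_gt_atTop 0)).exists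
    rw [← hU.nat_mul_zero_eq_pow hω.le] at hX
    exact (hU.nat_mul hω.le k).hasUniformExpDecay_of_norm_le (by positivity) (hleft _)
      (hright _) hX.le

end IsPeriodicEvolution

end Floquet

section Transition

variable {R F : Type*} [NormedRing R] [NormedAddCommGroup F] [Module R F]
  {A : ℝ → R} {U V : ℝ → ℝ → R} {x : ℝ → F} {J J' : Set ℝ} {c s t ω : ℝ} {C : R}

namespace SolvesOn

theorem comp_add [J.OrdConnected] (hx : SolvesOn A x J) (hJ : ∀ t ∈ J, t + ω ∈ J)
    (hper : ∀ t ∈ J, A (t + ω) - A t = C) : SolvesOn A (fun t => x (t + ω)) J :=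
  fun c hc d hd => by
    have hcd := OrdConnected.uIcc_subset ‹_› hc hd
    refine (IsIndefiniteIntegralOn.comp_add hx ω c (hJ c hc) d (hJ d hd)).congr_sub
      fun τ _ s hs t ht => ?_
    have : A (t + ω) - A (s + ω) = A t - A s := sub_eq_sub_iff_sub_eq_sub.1
      ((hper t (hcd ht)).trans (hper s (hcd hs)).symm)
    rw [← sub_smul, ← sub_smul, this]

variable [IsBoundedSMul R F]

theorem smul_const {Φ : ℝ → R} (hΦ : SolvesOn A Φ J) (v : F) :
    SolvesOn A (fun t => Φ t • v) J := by
  simpa [SolvesOn, mul_smul] using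
    hΦ.map ((smulAddHom R F).flip v) (continuous_id.smul continuous_const)

end SolvesOn

variable [IsBoundedSMul R F]

/-- Transition operators of `dx/dτ = D[A(t)x]` on `J`: `U(·, s)` is the operator-valued solution
with value `1` at `s`. -/
def IsTransitionOn (A : ℝ → R) (U : ℝ → ℝ → R) (J : Set ℝ) : Prop :=
  ∀ s ∈ J, U s s = 1 ∧ SolvesOn A (U · s) J

theorem exists_isTransitionOn_univ [CompleteSpace R] (hA : Admissible A) :
    ∃ U, IsTransitionOn A U univ := by
  choose Φ h1 hΦ using fun s => exists_solvesOn_univ hA s (1 : R)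
  exact ⟨fun t s => Φ s t, fun s _ => ⟨h1 s, hΦ s⟩⟩

namespace IsTransitionOn

theorem mono (hU : IsTransitionOn A U J) (hJ : J' ⊆ J) : IsTransitionOn A U J' :=
  fun s hs => ⟨(hU s (hJ hs)).1, (hU s (hJ hs)).2.mono hJ⟩

theorem eq_smul [J.OrdConnected] (hA : Admissible A) (hU : IsTransitionOn A U J)
    (hx : SolvesOn A x J) (hs : s ∈ J) (ht : t ∈ J) : x t = U t s • x s :=
  hx.eqOn hA ((hU s hs).2.smul_const (x s)) hs (by rw [(hU s hs).1, one_smul]) ht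

theorem mul [J.OrdConnected] (hA : Admissible A) (hU : IsTransitionOn A U J) (ht : t ∈ J)
    (hs : s ∈ J) (hc : c ∈ J) : U t s * U s c = U t c :=
  (hU.eq_smul hA (hU c hc).2 hs ht).symm

theorem eq [J.OrdConnected] (hA : Admissible A) (hU : IsTransitionOn A U J)
    (hV : IsTransitionOn A V J) (ht : t ∈ J) (hs : s ∈ J) : V t s = U t s := by
  rw [hU.eq_smul hA (hV s hs).2 hs ht, (hV s hs).1, smul_eq_mul, mul_one]

theorem mul_swap [J.OrdConnected] (hA : Admissible A) (hU : IsTransitionOn A U J) (ht : t ∈ J)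
    (hs : s ∈ J) : U t s * U s t = 1 := by
  rw [hU.mul hA ht hs ht, (hU t ht).1]

theorem isPeriodicEvolution (hA : Admissible A) (hU : IsTransitionOn A U (Ici 0)) (hω : 0 ≤ ω)
    (hper : ∀ t ≥ 0, A (t + ω) - A t = C) : IsPeriodicEvolution U ω where
  self t ht := (hU t ht).1
  mul t ht s hs r hr := hU.mul hA ht hs hr
  add_period t ht s hs := by
    have hsω : 0 ≤ s + ω := add_nonneg hs hω
    have hshift : SolvesOn A (fun t => U (t + ω) (s + ω)) (Ici 0) :=
      (hU (s + ω) hsω).2.comp_add (fun t ht => add_nonneg ht hω) hper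
    rw [hU.eq_smul hA hshift hs ht, (hU _ hsω).1, smul_eq_mul, mul_one]

theorem isRegulated_left [CompleteSpace R] (hA : Admissible A) (hU : IsTransitionOn A U univ)
    (c : ℝ) : IsRegulated (U · c) :=
  IsIndefiniteIntegralOn.isRegulated
    (isRegulated_of_locallyBoundedVariationOn hA.locallyBoundedVariationOn) (hU c trivial).2

/-- `U(c, ·)` inverts `U(·, c)`, whose one-sided limits are again invertible. -/
theorem isRegulated_right [CompleteSpace R] (hA : Admissible A) (hU : IsTransitionOn A U univ)
    (c : ℝ) : IsRegulated (U c) := fun t => by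
  let u : ℝ → Rˣ := fun s =>
    ⟨U s c, U c s, hU.mul_swap hA trivial trivial, hU.mul_swap hA trivial trivial⟩
  have hinv : U c = fun s => Ring.inverse (U s c) :=
    funext fun s => (Ring.inverse_unit (u s)).symm
  have hlim : ∀ {l : Filter ℝ} {B}, Tendsto (U · c) l (𝓝 ((1 + (B - A t)) * U t c)) →
      IsUnit (1 + (B - A t)) → ∃ v, Tendsto (U c) l (𝓝 v) := fun h hB => by
    obtain ⟨w, hw⟩ := hB.mul (u t).isUnit
    rw [hinv]
    exact ⟨_, (NormedRing.inverse_continuousAt w).tendsto.comp (hw ▸ h)⟩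
  obtain ⟨B, hB, hunit⟩ := hA.isUnit_left t
  obtain ⟨B', hB', hunit'⟩ := hA.isUnit_right t
  have hsol := fun a b => (hU c trivial).2.mono (subset_univ (Icc a b))
  exact ⟨hlim (SolvesOn.tendsto_nhdsLT (hsol _ _) (sub_one_lt t) hB) hunit,
    hlim (SolvesOn.tendsto_nhdsGT (hsol _ _) (lt_add_one t) hB') hunit'⟩

end IsTransitionOn

end Transition

section Spectrum

theorem tendsto_pow_iff_forall_mem_spectrum_norm_lt_one {𝓐 : Type*} [NormedRing 𝓐]
    [NormedAlgebra ℂ 𝓐] [CompleteSpace 𝓐] {a : 𝓐} :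
    Tendsto (fun k : ℕ => a ^ k) atTop (𝓝 0) ↔ ∀ z ∈ spectrum ℂ a, ‖z‖ < 1 := by
  constructor
  · intro h z hz
    rw [← tendsto_pow_atTop_nhds_zero_iff_norm_lt_one]
    have hlim := h.norm.mul_const ‖(1 : 𝓐)‖
    rw [norm_zero, zero_mul] at hlim
    exact squeeze_zero_norm
      (fun k => spectrum.norm_le_norm_mul_of_mem (spectrum.pow_mem_pow a k hz)) hlim
  · intro h
    have hrad : spectralRadius ℂ a < 1 := by
      rcases (spectrum ℂ a).eq_empty_or_nonempty with he | hne
      · simp [spectralRadius, he]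
      · exact spectrum.spectralRadius_lt_of_forall_lt_of_nonempty (r := 1) hne
          fun z hz => mod_cast h z hz
    obtain ⟨r, hr, hr1⟩ := ENNReal.lt_iff_exists_nnreal_btwn.1 hrad
    refine squeeze_zero_norm' ?_ (tendsto_pow_atTop_nhds_zero_of_lt_one r.coe_nonneg
      (mod_cast hr1))
    filter_upwards [(spectrum.pow_nnnorm_pow_one_div_tendsto_nhds_spectralRadius a).eventually
      (gt_mem_nhds hr), eventually_gt_atTop 0] with k hk hk0
    rw [one_div, ENNReal.rpow_inv_lt_iff (mod_cast hk0), ENNReal.rpow_natCast] at hk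
    exact_mod_cast hk.le

variable {n : Type*} [Fintype n] [DecidableEq n]

theorem tendsto_matrix_pow_iff_forall_hasEigenvalue_norm_lt_one (X : Matrix n n ℝ) :
    Tendsto (fun k : ℕ => X ^ k) atTop (𝓝 0) ↔ ∀ ρ : ℂ,
      Module.End.HasEigenvalue (Matrix.toLin' (X.map (algebraMap ℝ ℂ))) ρ → ‖ρ‖ < 1 := by
  have hpow : ∀ k, X.map (algebraMap ℝ ℂ) ^ k = (X ^ k).map (algebraMap ℝ ℂ) := fun k =>
    (map_pow (algebraMap ℝ ℂ).mapMatrix X k).symm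
  have hcomplex : Tendsto (fun k : ℕ => X ^ k) atTop (𝓝 0) ↔
      Tendsto (fun k : ℕ => X.map (algebraMap ℝ ℂ) ^ k) atTop (𝓝 0) := by
    simp only [hpow]
    constructor
    · intro h
      simpa [Function.comp_def] using ((continuous_id.matrix_map Complex.continuous_ofReal).tendsto
        (0 : Matrix n n ℝ)).comp h
    · intro h
      simpa [Function.comp_def] using ((continuous_id.matrix_map Complex.continuous_re).tendsto
        (0 : Matrix n n ℂ)).comp h
  simp only [hcomplex, tendsto_pow_iff_forall_mem_spectrum_norm_lt_one,
    Module.End.hasEigenvalue_iff_mem_spectrum, Matrix.spectrum_toLin']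

end Spectrum

section HalfLine

variable {R F : Type*} [NormedRing R] [NormedAddCommGroup F] [Module R F]
  {A A' : ℝ → R} {x : ℝ → F} {J : Set ℝ}

theorem SolvesOn.congr_coeff [J.OrdConnected] (hx : SolvesOn A x J) (hA : EqOn A A' J) :
    SolvesOn A' x J :=
  IsIndefiniteIntegralOn.congr hx (fun _ _ t ht => by rw [hA ht]) fun _ _ => rfl

theorem isTransitionOn_congr_coeff {U : ℝ → ℝ → R} [J.OrdConnected] (hA : EqOn A A' J) :
    IsTransitionOn A U J ↔ IsTransitionOn A' U J :=
  forall₂_congr fun _ _ => and_congr_right fun _ =>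
    ⟨fun h => h.congr_coeff hA, fun h => h.congr_coeff hA.symm⟩

theorem locallyBoundedVariationOn_extend (hA : LocallyBoundedVariationOn A (Ici 0)) :
    LocallyBoundedVariationOn (fun t => A (max t 0)) univ := fun a b _ _ => by
  refine ne_top_of_le_ne_top (hA _ _ (le_max_right a 0) (le_max_right b 0))
    (eVariationOn.comp_le_of_monotoneOn A (fun t => max t 0)
      (fun s _ t _ hst => max_le_max_right 0 hst) fun t ht => ?_)
  exact ⟨le_max_right t 0, max_le_max_right 0 ht.2.1, max_le_max_right 0 ht.2.2⟩

theorem admissible_extend [CompleteSpace R] (hA : LocallyBoundedVariationOn A (Ici 0))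
    (hl : ∀ t > 0, IsUnit (1 - (A t - Function.leftLim A t)))
    (hr : ∀ t ≥ 0, IsUnit (1 + (Function.rightLim A t - A t))) :
    Admissible fun t => A (max t 0) where
  locallyBoundedVariationOn := locallyBoundedVariationOn_extend hA
  isUnit_left t := by
    rcases le_or_gt t 0 with ht | ht
    · refine ⟨A 0, tendsto_const_nhds.congr' ?_, by simp [max_eq_right ht]⟩
      filter_upwards [self_mem_nhdsWithin] with s hs
      rw [max_eq_right ((le_of_lt hs).trans ht)]
    · obtain ⟨B, hB⟩ := (isRegulated_of_locallyBoundedVariationOn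
        (locallyBoundedVariationOn_extend hA) t).1
      have hB' : Tendsto A (𝓝[<] t) (𝓝 B) := hB.congr' <| by
        filter_upwards [Ioo_mem_nhdsLT ht] with s hs
        rw [max_eq_left hs.1.le]
      refine ⟨B, hB, ?_⟩
      rw [max_eq_left ht.le, ← leftLim_eq_of_tendsto hB', ← neg_sub, ← sub_eq_add_neg]
      exact hl t ht
  isUnit_right t := by
    rcases lt_or_ge t 0 with ht | ht
    · refine ⟨A 0, tendsto_const_nhds.congr' ?_, by simp [max_eq_right ht.le]⟩
      filter_upwards [Ioo_mem_nhdsGT ht] with s hs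
      rw [max_eq_right hs.2.le]
    · obtain ⟨B, hB⟩ := (isRegulated_of_locallyBoundedVariationOn
        (locallyBoundedVariationOn_extend hA) t).2
      have hB' : Tendsto A (𝓝[>] t) (𝓝 B) := hB.congr' <| by
        filter_upwards [self_mem_nhdsWithin] with s hs
        rw [max_eq_left (ht.trans (le_of_lt hs))]
      refine ⟨B, hB, ?_⟩
      rw [max_eq_left ht, ← rightLim_eq_of_tendsto hB']
      exact hr t ht

end HalfLine

section Matrix

variable {n : ℕ} {A A' : ℝ → Matrix (Fin n) (Fin n) ℝ} {U : ℝ → ℝ → Matrix (Fin n) (Fin n) ℝ}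

theorem toEuclideanCLM_eq_smul (M : Matrix (Fin n) (Fin n) ℝ) (v : EuclideanSpace ℝ (Fin n)) :
    Matrix.toEuclideanCLM (𝕜 := ℝ) M v = M • v := rfl

local instance isBoundedSMulMatrixEuclideanSpace :
    IsBoundedSMul (Matrix (Fin n) (Fin n) ℝ) (EuclideanSpace ℝ (Fin n)) :=
  .of_norm_smul_le fun M v => by
    rw [← Matrix.l2_opNorm_toEuclideanCLM M, ← toEuclideanCLM_eq_smul]
    exact ContinuousLinearMap.le_opNorm _ v

theorem isSolutionOn_iff_solvesOn {x : ℝ → EuclideanSpace ℝ (Fin n)} {J : Set ℝ} :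
    IsSolutionOn A x J ↔ SolvesOn A x J := Iff.rfl

theorem isTransitionMatrix_iff_isTransitionOn :
    IsTransitionMatrix A U ↔ IsTransitionOn A U (Ici 0) := by
  constructor
  · intro h s hs
    have h1 : U s s = 1 := sub_eq_zero.1 (h s hs s hs).eq_zero
    refine ⟨h1, .of_base (s := s) fun t ht => ?_⟩
    rw [h1]
    exact h t ht s hs
  · intro h t ht s hs
    rw [← (h s hs).1]
    exact (h s hs).2 s hs t ht

theorem globallyUniformlyExponentiallyStable_iff_hasUniformExpDecay (hA : Admissible A')
    (hAA' : EqOn A A' (Ici 0)) (hU : IsTransitionOn A' U (Ici 0)) :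
    GloballyUniformlyExponentiallyStable A ↔ HasUniformExpDecay U := by
  refine exists_congr fun α => and_congr_right fun _ => exists_congr fun K =>
    and_congr_right fun hK => forall₂_congr fun s hs => ?_
  have hsub : Ici s ⊆ Ici (0 : ℝ) := Ici_subset_Ici.2 hs
  constructor
  · intro h t hst
    rw [← Matrix.l2_opNorm_toEuclideanCLM]
    refine ContinuousLinearMap.opNorm_le_bound _ (by positivity) fun v => ?_
    have hx : SolvesOn A (fun t => U t s • v) (Ici s) :=
      (((hU.mono hsub s self_mem_Ici).2).smul_const v).congr_coeff (hAA'.symm.mono hsub)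
    have := h _ (isSolutionOn_iff_solvesOn.2 hx) t hst
    rw [(hU s hs).1, one_smul] at this
    exact this.trans_eq (by ring)
  · intro h x hx t hst
    have hx' : SolvesOn A' x (Ici s) :=
      (isSolutionOn_iff_solvesOn.1 hx).congr_coeff (hAA'.mono hsub)
    rw [(hU.mono hsub).eq_smul hA hx' self_mem_Ici hst]
    refine (norm_smul_le _ _).trans ?_
    exact (mul_le_mul_of_nonneg_right (h t hst) (norm_nonneg _)).trans_eq (by ring)

end Matrix

end GLDE

open Filter Topology GLDE

theorem corollary3p7 (n : ℕ) (A : ℝ → Matrix (Fin n) (Fin n) ℝ)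
    (hA : LocallyBoundedVariationOn A (Set.Ici 0)) (hD : GLDE.ConditionD A)
    (ω : ℝ) (hω : 0 < ω) (C : Matrix (Fin n) (Fin n) ℝ)
    (hper : ∀ t ≥ 0, A (t + ω) - A t = C) :
    ∃ U : ℝ → ℝ → Matrix (Fin n) (Fin n) ℝ,
      GLDE.IsTransitionMatrix A U ∧
      (∀ V : ℝ → ℝ → Matrix (Fin n) (Fin n) ℝ, GLDE.IsTransitionMatrix A V →
        ∀ t ≥ 0, ∀ s ≥ 0, V t s = U t s) ∧
      (GLDE.GloballyUniformlyExponentiallyStable A ↔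
        ∀ ρ : ℂ, Module.End.HasEigenvalue
          (Matrix.toLin' ((U ω 0).map (algebraMap ℝ ℂ))) ρ → ‖ρ‖ < 1) := by
  let A₀ : ℝ → Matrix (Fin n) (Fin n) ℝ := fun t => A (max t 0)
  have hA₀ : Admissible A₀ := admissible_extend hA hD.1 hD.2
  have hAA₀ : EqOn A A₀ (Ici 0) := fun t ht => (congrArg A (max_eq_left ht)).symm
  have hper₀ : ∀ t ≥ 0, A₀ (t + ω) - A₀ t = C := fun t ht => by
    rw [← hAA₀ ht, ← hAA₀ (add_nonneg ht hω.le), hper t ht]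
  have htrans : ∀ V, IsTransitionMatrix A V ↔ IsTransitionOn A₀ V (Ici 0) := fun V =>
    isTransitionMatrix_iff_isTransitionOn.trans (isTransitionOn_congr_coeff hAA₀)
  obtain ⟨U, hU⟩ := exists_isTransitionOn_univ hA₀
  have hU₀ : IsTransitionOn A₀ U (Ici 0) := hU.mono (subset_univ _)
  refine ⟨U, (htrans U).2 hU₀, fun V hV t ht s hs => hU₀.eq hA₀ ((htrans V).1 hV) ht hs, ?_⟩
  rw [globallyUniformlyExponentiallyStable_iff_hasUniformExpDecay hA₀ hAA₀ hU₀,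
    (hU₀.isPeriodicEvolution hA₀ hω.le hper₀).hasUniformExpDecay_iff_tendsto_pow hω
      (fun b => (hU.isRegulated_left hA₀ 0).isBounded_image_Icc 0 b)
      fun b => (hU.isRegulated_right hA₀ 0).isBounded_image_Icc 0 b,
    tendsto_matrix_pow_iff_forall_hasEigenvalue_norm_lt_one]
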